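/- **Theorem (WAP Representation Theorem).** Let $S$ be a semitopological semigroup (a semigroup with a topology for which multiplication is separately continuous) and let $X$ be a semitopological $S$-flow: a topological space with a separately continuous left action $S\times X\to X$, $(s,x)\mapsto sx$, such that the identity of $S$, if there is one, acts as the identity map. Let $C(X)$ be the Banach space of bounded continuous real-valued functions on $X$ with the supremum norm. A function $f:X\to\mathbb R$ is called *weakly almost periodic* (wap) if $f\in C(X)$ and its orbit $\{x\mapsto f(sx) : s\in S\}$ is relatively compact in the weak topology of $C(X)$. For a real Banach space $V$ let $\Theta(V)$ be the semigroup of bounded linear operators on $V$ of norm at most $1$, and let $B^*$ be the closed unit ball of $V^*$ with the weak$^*$ topology. Consider pairs $(h,\alpha)$ where $h:S\to\Theta(V)$ is an antihomomorphism of semigroups, $h(st)=h(t)h(s)$, and $\alpha:X\to B^*$ is a weak$^*$ continuous map which is equivariant, i.e. $\langle v,\alpha(sx)\rangle=\langle h(s)v,\alpha(x)\rangle$ for all $s\in S$, $x\in X$, $v\in V$. For every $f:X\to\mathbb R$ the following are equivalent: 1. $f$ is weakly almost periodic. 2. There are a reflexive Banach space $V$, a pair $(h,\alpha)$ as above with $h$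 continuous for the weak operator topology on $\Theta(V)$ and mapping the identity of $S$ (if there is one) to the identity operator, and a vector $v\in V$ such that $f(x)=\langle v,\alpha(x)\rangle$ for all $x\in X$. 3. There are a reflexive Banach space $V$, a pair $(h,\alpha)$ as above (with no continuity of $h$ and no preservation of the identity required) and a vector $v\in V$ such that $f(x)=\langle v,\alpha(x)\rangle$ for all $x\in X$. Moreover, if either (a) $S$ is a group (with separately continuous multiplication), or (b) $X$ is compact Hausdorff and the action $S\times X\to X$ is jointly continuous, then "weak operator topology" in 2 can be replaced by "strong operator topology" (the topology of pointwise norm convergence). -/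

import Mathlib

open scoped BoundedContinuousFunction

universe u v w

noncomputable section

/-- `e` is a two-sided identity of the semigroup `S`. -/
def IsIdentityElement {S : Type*} [Semigroup S] (e : S) : Prop :=
  ∀ s : S, e * s = s ∧ s * e = s

/-- The semigroup `S` is (algebraically) a group. -/
def IsGroupSemigroup (S : Type*) [Semigroup S] : Prop :=
  ∃ e : S, IsIdentityElement e ∧ ∀ s : S, ∃ t : S, t * s = e ∧ s * t = e

/-- `(S, X)` is a semitopological (left) flow: `S` is a semigroup with separately continuous
multiplication, acting on the space `X` by a separately continuous action; if `S` has an identity,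
it acts as the identity transformation of `X`. -/
class SemitopologicalFlow (S X : Type*) [Semigroup S] [TopologicalSpace S] [TopologicalSpace X]
    [SemigroupAction S X] : Prop extends SeparatelyContinuousMul S, ContinuousConstSMul S X where
  continuous_orbit : ∀ x : X, Continuous fun s : S => s • x
  identity_smul : ∀ e : S, IsIdentityElement e → ∀ x : X, e • x = x

/-- The translate `x ↦ F (s • x)` of a bounded continuous function `F` on `X`. -/
def flowTranslate {S X : Type*} [TopologicalSpace X] [SMul S X] [ContinuousConstSMul S X]
    (F : X →ᵇ ℝ) (s : S) : X →ᵇ ℝ :=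
  F.compContinuous ⟨fun x => s • x, continuous_const_smul s⟩

/-- `f : X → ℝ` is weakly almost periodic: it is bounded and continuous, and its orbit of
translates is relatively compact in the weak topology of the Banach space of bounded continuous
functions on `X`. -/
def IsWAP (S : Type*) {X : Type*} [TopologicalSpace X] [SMul S X] [ContinuousConstSMul S X]
    (f : X → ℝ) : Prop :=
  ∃ F : X →ᵇ ℝ, ⇑F = f ∧
    IsCompact (closure (toWeakSpace ℝ (X →ᵇ ℝ) '' Set.range fun s : S => flowTranslate F s))

/-- Reflexivity of a normed space: the canonical map into the bidual is onto. -/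
def IsReflexiveSpace (V : Type*) [NormedAddCommGroup V] [NormedSpace ℝ V] : Prop :=
  Function.Surjective (NormedSpace.inclusionInDoubleDual ℝ V)

/-- The semigroup `Θ(V)` of linear operators on `V` of norm at most `1`. -/
def Contractions (V : Type*) [NormedAddCommGroup V] [NormedSpace ℝ V] :
    Submonoid (V →L[ℝ] V) where
  carrier := {σ | ‖σ‖ ≤ 1}
  mul_mem' {σ τ} hσ hτ := (norm_mul_le σ τ).trans (mul_le_one₀ hσ (norm_nonneg τ) hτ)
  one_mem' := ContinuousLinearMap.norm_id_le

/-- The closed unit ball `B(V*)` of the dual, with the weak* topology. -/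
def DualBall (V : Type*) [NormedAddCommGroup V] [NormedSpace ℝ V] : Set (WeakDual ℝ V) :=
  WeakDual.toStrongDual ⁻¹' Metric.closedBall 0 1

/-- An equivariant pair `(h, α) : (S, X) ⇉ (Θ(V)ᵒᵖᵖ, B(V*))`: a homomorphism of semigroups
`h : S → Θ(V)ᵒᵖᵖ` (no continuity) and a weak* continuous map `α : X → B(V*)` such that
`α (s • x) = h(s)* (α x)`, where `h(s)*` is the adjoint of the operator `h(s)`. -/
structure EquivariantPair (S X V : Type*) [Semigroup S] [TopologicalSpace X] [SemigroupAction S X]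
    [NormedAddCommGroup V] [NormedSpace ℝ V] where
  h : S →ₙ* (Contractions V)ᵐᵒᵖ
  α : X → DualBall V
  continuous_α : Continuous α
  equivariant : ∀ (s : S) (x : X) (v : V),
    (α (s • x) : WeakDual ℝ V) v = (α x : WeakDual ℝ V) (((h s).unop : V →L[ℝ] V) v)

namespace EquivariantPair

variable {S X V : Type*} [Semigroup S] [TopologicalSpace X] [SemigroupAction S X]
  [NormedAddCommGroup V] [NormedSpace ℝ V]

/-- If `S` has an identity, `h` maps it to the identity operator. -/
def PreservesIdentity (r : EquivariantPair S X V) : Prop :=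
  ∀ e : S, IsIdentityElement e → r.h e = 1

/-- `h` is continuous for the weak operator topology. -/
def IsWeaklyContinuous [TopologicalSpace S] (r : EquivariantPair S X V) : Prop :=
  Continuous fun s : S =>
    (ContinuousLinearMap.WOTofCLM ((r.h s).unop : V →L[ℝ] V) : V →WOT[ℝ] V)

/-- `h` is continuous for the strong operator topology (pointwise norm convergence). -/
def IsStronglyContinuous [TopologicalSpace S] (r : EquivariantPair S X V) : Prop :=
  Continuous fun s : S =>
    (ContinuousLinearMap.toPointwiseConvergenceCLM ℝ (RingHom.id ℝ) V V
      ((r.h s).unop : V →L[ℝ] V) : V →Lₚₜ[ℝ] V)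

/-- `f x = ⟨v, α x⟩` for all `x`. -/
def Represents (r : EquivariantPair S X V) (v : V) (f : X → ℝ) : Prop :=
  ∀ x : X, f x = (r.α x : WeakDual ℝ V) v

end EquivariantPair

end

open Filter Topology Set Metric

/-! ### Weak compactness through ultrafilters; the theorems of Alaoglu, Helly and Goldstine -/

section WeakTopology

variable {E : Type*} [NormedAddCommGroup E] [NormedSpace ℝ E]

/-! The implication 3 → 1 is soft. The operator v ↦ (x ↦ ⟨v, α x⟩) from V to C(X) intertwines h with
translation, and each h(s) is a contraction. The orbit of f therefore lies in the image of a ball of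
V, which is weakly compact because V is reflexive. Continuity of h plays no role.

For 1 → 2, the space V is built inside C(X). Let W be the absolutely convex hull of a multiple of f
and its translates. Krein's theorem puts W inside a weakly compact set. The interpolation of Davis,
Figiel, Johnson and Pełczyński takes the gauges p_n of 2^n W + 2^(-n-1) B, where B is the unit ball,
and the norm (∑ p_n²)^(1/2). Weak compactness makes this space reflexive
(`isReflexiveSpace_of_isClosed_image`). Translations preserve W and map B into itself, so they
decrease every p_n and act on V by contractions. The point α(x) is evaluation at x. Evaluations
separate V, and on bounded subsets of a reflexive space this is enough to test weak continuity of s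
↦ h(s)v.

Krein's theorem rests on barycenters of states on a weakly compact K. If a barycenter fell outside
E, Helly's theorem would give functionals in the dual ball tending to 0 pointwise on K while the
state stays away from 0 on them, against dominated convergence.

Strong continuity has two sources. For a group the operators are isometries acting transitively on
an orbit. A weakly compact set has nonempty relatively weakly open pieces of small norm diameter
(`exists_isOpen_norm_sub_le`, from countable tightness and Baire category), and transitivity carries
such a piece to every point. For a jointly continuous action on a compact space, translation is
already norm continuous on C(X), and domination of the series ∑ p_n² transfers this to V. -/

theorem injective_topDualPairing_flip :
    Function.Injective (topDualPairing ℝ E).flip := fun x y h => by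
  by_contra hne
  obtain ⟨f, hf⟩ := SeparatingDual.exists_separating_of_ne (R := ℝ) hne
  exact hf (DFunLike.congr_fun h f)

/-- Weak compactness of `K`, in terms of ultrafilters on the underlying space. -/
theorem isCompact_image_toWeakSpace_iff {K : Set E} :
    IsCompact (toWeakSpace ℝ E '' K) ↔ ∀ 𝒰 : Ultrafilter E, K ∈ 𝒰 →
      ∃ x ∈ K, ∀ φ : StrongDual ℝ E, Tendsto φ 𝒰 (𝓝 (φ x)) := by
  rw [isCompact_iff_ultrafilter_le_nhds']
  constructor
  · intro h 𝒰 hK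
    obtain ⟨_, ⟨x, hx, rfl⟩, hle⟩ := h (𝒰.map (toWeakSpace ℝ E)) (image_mem_map hK)
    exact ⟨x, hx, fun φ =>
      (WeakBilin.tendsto_iff_forall_eval_tendsto _ injective_topDualPairing_flip).1 hle φ⟩
  · intro h 𝒰 hK
    obtain ⟨x, hx, hφ⟩ := h (𝒰.map (toWeakSpace ℝ E).symm) (by
      have := image_mem_map (m := (toWeakSpace ℝ E).symm) hK
      simpa [image_image] using this)
    refine ⟨_, mem_image_of_mem _ hx, ?_⟩
    exact (WeakBilin.tendsto_iff_forall_eval_tendsto (l := (𝒰 : Filter (WeakSpace ℝ E)))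
      (f := fun y => y) _ injective_topDualPairing_flip).2 fun φ => hφ φ

/-- The Banach-Alaoglu theorem for bounded families of functionals. -/
theorem exists_tendsto_of_norm_le {ι : Type*} (𝒰 : Ultrafilter ι) (φ : ι → StrongDual ℝ E) (r : ℝ)
    (h : ∀ᶠ i in 𝒰, ‖φ i‖ ≤ r) :
    ∃ ψ : StrongDual ℝ E, ‖ψ‖ ≤ r ∧ ∀ x, Tendsto (fun i => φ i x) 𝒰 (𝓝 (ψ x)) := by
  obtain ⟨ψ, hψ, hle⟩ := isCompact_iff_ultrafilter_le_nhds'.1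
    (WeakDual.isCompact_closedBall (𝕜 := ℝ) (E := E) 0 r)
    (𝒰.map fun i => StrongDual.toWeakDual (φ i)) (Ultrafilter.mem_map.2 (by
      filter_upwards [h] with i hi
      simpa using hi))
  refine ⟨WeakDual.toStrongDual ψ, by simpa using hψ, fun x => ?_⟩
  exact ((WeakDual.eval_continuous x).tendsto ψ).comp (show Tendsto _ _ _ from hle)

/-- Helly's theorem on the approximate solvability of finite systems of linear equations. -/
theorem exists_norm_le_forall_abs_sub_lt {ι : Type*} [Fintype ι] (φ : ι → StrongDual ℝ E)
    (a : ι → ℝ) {M : ℝ} (hM : 0 ≤ M) (h : ∀ c : ι → ℝ, ∑ i, c i * a i ≤ M * ‖∑ i, c i • φ i‖)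
    {ε : ℝ} (hε : 0 < ε) : ∃ x, ‖x‖ ≤ M ∧ ∀ i, |φ i x - a i| < ε := by
  classical
  set T : E →L[ℝ] (ι → ℝ) := ContinuousLinearMap.pi φ
  set A := T '' closedBall 0 M
  have hA : Convex ℝ A := (convex_closedBall 0 M).linear_image T.toLinearMap
  suffices ha : a ∈ closure A by
    obtain ⟨_, ⟨x, hx, rfl⟩, hd⟩ := Metric.mem_closure_iff.1 ha ε hε
    refine ⟨x, by simpa using hx, fun i => ?_⟩
    have := (dist_pi_lt_iff hε).1 hd i
    rwa [dist_comm, Real.dist_eq] at this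
  by_contra ha
  obtain ⟨f, u, hfu, hua⟩ := geometric_hahn_banach_closed_point hA.closure isClosed_closure ha
  have hf : ∀ b : ι → ℝ, f b = ∑ i, f (Pi.single i 1) * b i := fun b => by
    conv_lhs => rw [pi_eq_sum_univ' b]
    simp [map_sum, mul_comm]
  set c : ι → ℝ := fun i => f (Pi.single i 1)
  set g := ∑ i, c i • φ i
  have hg : ∀ x, ‖x‖ ≤ M → g x < u := fun x hx => by
    have := hfu (T x) (subset_closure ⟨x, by simpa using hx, rfl⟩)
    rw [hf] at this
    simpa [g, T] using this
  -- The functional g stays below u on the ball of radius M, so M‖g‖ ≤ u < f a = ∑ c i * a i, which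
  -- contradicts `h`.
  have hgu : M * ‖g‖ ≤ u := by
    have hu : 0 < u := by simpa using hg 0 (by simpa using hM)
    rcases hM.eq_or_lt with rfl | hM
    · simpa using hu.le
    rw [mul_comm, ← le_div_iff₀ hM]
    refine g.opNorm_le_of_unit_norm (by positivity) fun x hx => ?_
    rw [le_div_iff₀ hM, Real.norm_eq_abs]
    rcases abs_cases (g x) with ⟨h, -⟩ | ⟨h, -⟩ <;> rw [h]
    · have := hg (M • x) (by rw [norm_smul, hx, Real.norm_of_nonneg hM.le, mul_one])
      simp at this; linarith
    · have := hg (-(M • x)) (by rw [norm_neg, norm_smul, hx, Real.norm_of_nonneg hM.le, mul_one])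
      simp at this; linarith
  have := h c
  rw [hf] at hua
  linarith

/-- Goldstine's theorem. -/
theorem exists_ultrafilter_tendsto_bidual (Φ : StrongDual ℝ (StrongDual ℝ E)) {M : ℝ}
    (hΦ : ‖Φ‖ ≤ M) : ∃ 𝒰 : Ultrafilter E, closedBall 0 M ∈ 𝒰 ∧
      ∀ ψ : StrongDual ℝ E, Tendsto ψ 𝒰 (𝓝 (Φ ψ)) := by
  classical
  have key : ∀ p : Finset (StrongDual ℝ E) × ℕ, ∃ x : E, ‖x‖ ≤ M ∧
      ∀ ψ ∈ p.1, |ψ x - Φ ψ| < 1 / (p.2 + 1 : ℝ) := fun p => by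
    have hc : ∀ c : p.1 → ℝ, ∑ i, c i * Φ i ≤ M * ‖∑ i, c i • (i : StrongDual ℝ E)‖ := fun c => by
      calc ∑ i, c i * Φ i = Φ (∑ i, c i • (i : StrongDual ℝ E)) := by simp [map_sum]
        _ ≤ ‖Φ (∑ i, c i • (i : StrongDual ℝ E))‖ := Real.le_norm_self _
        _ ≤ _ := Φ.le_of_opNorm_le hΦ _
    obtain ⟨x, hx, h⟩ := exists_norm_le_forall_abs_sub_lt (fun i : p.1 => (i : StrongDual ℝ E))
      (fun i => Φ i) ((norm_nonneg Φ).trans hΦ) hc (Nat.one_div_pos_of_nat (α := ℝ) (n := p.2))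
    exact ⟨x, hx, fun ψ hψ => h ⟨ψ, hψ⟩⟩
  choose x hx hxψ using key
  refine ⟨(Ultrafilter.of atTop).map x, ?_, fun ψ => ?_⟩
  · exact Ultrafilter.mem_map.2 (Filter.univ_mem' fun p => by simpa using hx p)
  · refine Tendsto.mono_left ?_ (map_mono (Ultrafilter.of_le _))
    rw [tendsto_map'_iff, Metric.tendsto_atTop]
    intro ε hε
    obtain ⟨n, hn⟩ := exists_nat_one_div_lt hε
    refine ⟨({ψ}, n), fun p hp => ?_⟩
    rw [Real.dist_eq]
    refine (hxψ p ψ (hp.1 (Finset.mem_singleton_self ψ))).trans (lt_of_le_of_lt ?_ hn)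
    have : (n : ℝ) ≤ p.2 := by exact_mod_cast hp.2
    exact one_div_le_one_div_of_le (by positivity) (by linarith)

/-- Alaoglu's theorem gives the limit in the bidual, and surjectivity of the canonical isometry
brings it back to the space. -/
theorem IsReflexiveSpace.exists_tendsto (hE : IsReflexiveSpace E) (𝒰 : Ultrafilter E) {r : ℝ}
    (h : closedBall 0 r ∈ 𝒰) : ∃ x, ‖x‖ ≤ r ∧ ∀ φ : StrongDual ℝ E, Tendsto φ 𝒰 (𝓝 (φ x)) := by
  obtain ⟨Ψ, hΨ, ht⟩ := exists_tendsto_of_norm_le 𝒰 (NormedSpace.inclusionInDoubleDual ℝ E) r (by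
    filter_upwards [h] with x hx
    exact (NormedSpace.double_dual_bound ℝ E x).trans (by simpa using hx))
  obtain ⟨x, rfl⟩ := hE Ψ
  exact ⟨x, by rwa [← (NormedSpace.inclusionInDoubleDualLi (E := E) ℝ).norm_map x], ht⟩

/-- Closed balls of a reflexive space are weakly compact. -/
theorem IsReflexiveSpace.isCompact_closedBall (hE : IsReflexiveSpace E) (r : ℝ) :
    IsCompact (toWeakSpace ℝ E '' closedBall 0 r) :=
  isCompact_image_toWeakSpace_iff.2 fun 𝒰 h => by
    obtain ⟨x, hx, ht⟩ := hE.exists_tendsto 𝒰 h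
    exact ⟨x, by simpa using hx, ht⟩

/-- A limit in the weak topology of points of a closed convex set belongs to that set. -/
theorem mem_of_forall_tendsto {ι : Type*} {l : Filter ι} [l.NeBot] {C : Set E} (hC : Convex ℝ C)
    (hC' : IsClosed C) {z : ι → E} {x : E} (hz : ∀ᶠ i in l, z i ∈ C)
    (ht : ∀ φ : StrongDual ℝ E, Tendsto (fun i => φ (z i)) l (𝓝 (φ x))) : x ∈ C := by
  by_contra hx
  obtain ⟨f, u, hfu, hux⟩ := geometric_hahn_banach_closed_point hC hC' hx
  exact hux.not_ge (le_of_tendsto (ht f) (hz.mono fun i hi => (hfu _ hi).le))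

/-- Weakly compact sets are bounded. -/
theorem exists_subset_closedBall_of_isCompact_toWeakSpace {K : Set E}
    (hK : IsCompact (toWeakSpace ℝ E '' K)) : ∃ r, 0 < r ∧ K ⊆ closedBall 0 r := by
  -- The points of K act on the Banach space dual to E. They are pointwise bounded there because
  -- each φ(K) is compact.
  obtain ⟨C, hC⟩ := banach_steinhaus (ι := K) (𝕜 := ℝ) (𝕜₂ := ℝ)
    (g := fun x => NormedSpace.inclusionInDoubleDual ℝ E x) fun φ => by
      have : IsCompact (φ '' K) := by
        have := hK.image (f := fun x : WeakSpace ℝ E => φ ((toWeakSpace ℝ E).symm x))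
          (WeakBilin.eval_continuous (topDualPairing ℝ E).flip φ)
        simpa [image_image] using this
      obtain ⟨r, hr⟩ := this.isBounded.exists_norm_le
      exact ⟨r, fun x => hr _ ⟨x, x.2, rfl⟩⟩
  refine ⟨max C 1, by positivity, fun x hx => ?_⟩
  have := hC ⟨x, hx⟩
  simp only at this
  rw [mem_closedBall_zero_iff, ← (NormedSpace.inclusionInDoubleDualLi (E := E) ℝ).norm_map x]
  exact this.trans (le_max_left _ _)

end WeakTopology

/-! ### States and dominated convergence -/

section States

variable {X : Type*} [TopologicalSpace X] [CompactSpace X]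

/-- States of the algebra of continuous functions on a compact space. -/
def IsState (Λ : StrongDual ℝ C(X, ℝ)) : Prop :=
  (∀ g, 0 ≤ g → 0 ≤ Λ g) ∧ Λ 1 = 1

theorem IsState.norm_le {Λ : StrongDual ℝ C(X, ℝ)} (hΛ : IsState Λ) : ‖Λ‖ ≤ 1 := by
  refine Λ.opNorm_le_bound zero_le_one fun g => ?_
  rw [one_mul, Real.norm_eq_abs, abs_le]
  have hg : ∀ x, |g x| ≤ ‖g‖ := fun x => g.norm_coe_le_norm x
  constructor
  · have := hΛ.1 (‖g‖ • 1 + g) fun x => by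
      have := (abs_le.1 (hg x)).1
      simpa using by linarith
    simp [hΛ.2] at this
    linarith
  · have := hΛ.1 (‖g‖ • 1 - g) fun x => by
      have := (abs_le.1 (hg x)).2
      simpa using by linarith
    simp [hΛ.2] at this
    linarith

/-- Bounded pointwise convergence implies convergence under every state. -/
theorem IsState.tendsto_zero [T2Space X] {Λ : StrongDual ℝ C(X, ℝ)} (hΛ : IsState Λ)
    {g : ℕ → C(X, ℝ)} {r : ℝ} (hr : ∀ n, ‖g n‖ ≤ r)
    (hg : ∀ x, Tendsto (fun n => g n x) atTop (𝓝 0)) : Tendsto (fun n => Λ (g n)) atTop (𝓝 0) := by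
  borelize X
  -- The Riesz–Markov theorem turns the state into a finite measure, for which the constant r is an
  -- integrable bound.
  let Λ' : CompactlySupportedContinuousMap X ℝ →ₚ[ℝ] ℝ := PositiveLinearMap.mk₀
    { toFun := fun f => Λ (f : C(X, ℝ))
      map_add' := fun f f' => by rw [← map_add]; rfl
      map_smul' := fun c f => by rw [RingHom.id_apply, ← map_smul]; rfl }
    fun f hf => hΛ.1 _ hf
  have hint : ∀ n, ∫ x, g n x ∂(RealRMK.rieszMeasure Λ') = Λ (g n) := fun n =>
    RealRMK.integral_rieszMeasure Λ' (CompactlySupportedContinuousMap.continuousMapEquiv (g n))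
  have := MeasureTheory.tendsto_integral_of_dominated_convergence
    (μ := RealRMK.rieszMeasure Λ') (F := fun n x => g n x) (f := fun _ => (0 : ℝ)) (fun _ => r)
    (fun n => (g n).continuous.aestronglyMeasurable) (MeasureTheory.integrable_const r)
    (fun n => .of_forall fun x => ((g n).norm_coe_le_norm x).trans (hr n))
    (.of_forall hg)
  simpa [hint] using this

end States

/-! ### Barycenters and Krein's theorem -/

section Krein

variable {E : Type*} [NormedAddCommGroup E] [NormedSpace ℝ E] {K : Set E}

/-- The restriction of continuous functionals to a set with the weak topology. -/
noncomputable def restrictWeak (K : Set E) : StrongDual ℝ E →ₗ[ℝ] C(toWeakSpace ℝ E '' K, ℝ) where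
  toFun φ := ⟨fun x => φ ((toWeakSpace ℝ E).symm x),
    (WeakBilin.eval_continuous (topDualPairing ℝ E).flip φ).comp continuous_subtype_val⟩
  map_add' _ _ := rfl
  map_smul' _ _ := rfl

theorem restrictWeak_apply (φ : StrongDual ℝ E) {x : E} (hx : x ∈ K) :
    restrictWeak K φ ⟨toWeakSpace ℝ E x, mem_image_of_mem _ hx⟩ = φ x := rfl

theorem norm_restrictWeak_le [CompactSpace (toWeakSpace ℝ E '' K)] {r : ℝ} (hr : 0 ≤ r)
    (hK : K ⊆ closedBall 0 r) (φ : StrongDual ℝ E) : ‖restrictWeak K φ‖ ≤ r * ‖φ‖ := by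
  refine (ContinuousMap.norm_le _ (by positivity)).2 ?_
  rintro ⟨_, x, hx, rfl⟩
  rw [restrictWeak_apply φ hx, mul_comm]
  exact φ.le_of_opNorm_le_of_le le_rfl (by simpa using hK hx)

/-- A finite set of points of a weakly compact set which is a net for finitely many functionals. -/
theorem exists_finset_net (hK : IsCompact (toWeakSpace ℝ E '' K)) (A : Finset (StrongDual ℝ E))
    {δ : ℝ} (hδ : 0 < δ) : ∃ D : Finset E, (D : Set E) ⊆ K ∧
      ∀ x ∈ K, ∃ d ∈ D, ∀ φ ∈ A, |φ x - φ d| < δ := by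
  classical
  have hc : Continuous fun (x : WeakSpace ℝ E) (φ : A) =>
      (φ : StrongDual ℝ E) ((toWeakSpace ℝ E).symm x) :=
    continuous_pi fun φ => WeakBilin.eval_continuous (topDualPairing ℝ E).flip (φ : StrongDual ℝ E)
  have himg := hK.image hc
  rw [image_image] at himg
  obtain ⟨t, htK, ht, hcov⟩ := himg.finite_cover_balls hδ
  lift t to Finset (A → ℝ) using ht
  obtain ⟨D, hDK, rfl⟩ := Finset.subset_set_image_iff.1 htK
  refine ⟨D, hDK, fun x hx => ?_⟩
  have := hcov ⟨x, hx, rfl⟩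
  simp only [Finset.coe_image, mem_iUnion] at this
  obtain ⟨_, ⟨d, hd, rfl⟩, hdist⟩ := this
  refine ⟨d, hd, fun φ hφ => ?_⟩
  have := (dist_pi_lt_iff hδ).1 (mem_ball.1 hdist) ⟨φ, hφ⟩
  rwa [Real.dist_eq] at this

/-- An element of the bidual at distance at least `ε` from `E` takes the value `ε`, up to a small
error, at functionals of norm at most `1` which are small on a given finite set. -/
theorem exists_small_functional {Φ : StrongDual ℝ (StrongDual ℝ E)} {ε : ℝ}
    (hε : 0 ≤ ε) (hΦ : ∀ y, ε ≤ ‖Φ - NormedSpace.inclusionInDoubleDual ℝ E y‖) (D : Finset E)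
    {δ : ℝ} (hδ : 0 < δ) :
    ∃ φ : StrongDual ℝ E, ‖φ‖ ≤ 1 ∧ |Φ φ - ε| < δ ∧ ∀ d ∈ D, |φ d| < δ := by
  set J := NormedSpace.inclusionInDoubleDual ℝ E
  obtain ⟨φ, hφ, h⟩ := exists_norm_le_forall_abs_sub_lt
    (fun i : Option D => i.elim Φ fun d => J d) (fun i => i.elim ε fun _ => 0) zero_le_one
    (fun c => by
      simp only [Fintype.sum_option, Option.elim, mul_zero, Finset.sum_const_zero, add_zero,
        one_mul]
      rcases le_or_gt (c none) 0 with hc | hc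
      · exact (mul_nonpos_of_nonpos_of_nonneg hc hε).trans (norm_nonneg _)
      -- Dividing by the positive coefficient of Φ leaves Φ minus a point of E, whose norm is at
      -- least ε.
      · set y := -(c none)⁻¹ • ∑ d : D, c (some d) • (d : E)
        have : c none • Φ + ∑ d : D, c (some d) • J d = c none • (Φ - J y) := by
          simp [y, smul_smul, hc.ne', map_sum]
        rw [this, norm_smul, Real.norm_of_nonneg hc.le]
        exact mul_le_mul_of_nonneg_left (hΦ y) hc.le) hδ
  refine ⟨φ, hφ, h none, fun d hd => ?_⟩
  simpa [J] using h (some ⟨d, hd⟩)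

/-- Every state on a weakly compact set has a barycenter. -/
theorem IsState.exists_barycenter [CompleteSpace E] (hK : IsCompact (toWeakSpace ℝ E '' K))
    [CompactSpace (toWeakSpace ℝ E '' K)] {Λ : StrongDual ℝ C(toWeakSpace ℝ E '' K, ℝ)}
    (hΛ : IsState Λ) : ∃ x : E, ∀ φ, Λ (restrictWeak K φ) = φ x := by
  classical
  obtain ⟨r, hr, hKr⟩ := exists_subset_closedBall_of_isCompact_toWeakSpace hK
  set J := NormedSpace.inclusionInDoubleDual ℝ E
  let Φ : StrongDual ℝ (StrongDual ℝ E) := (Λ.toLinearMap.comp (restrictWeak K)).mkContinuous r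
    fun φ => (Λ.le_of_opNorm_le hΛ.norm_le _).trans
      (by rw [one_mul]; exact norm_restrictWeak_le hr.le hKr φ)
  have hΦ : ∀ φ, Φ φ = Λ (restrictWeak K φ) := fun φ => rfl
  by_contra hne
  have hrange : IsClosed (range J) :=
    ((NormedSpace.inclusionInDoubleDualLi (E := E) ℝ).isometry.isUniformInducing.isComplete_range
      :).isClosed
  have hΦr : Φ ∉ range J := by
    rintro ⟨x, hx⟩
    exact hne ⟨x, fun φ => by rw [← hΦ, ← hx]; rfl⟩
  obtain ⟨ε, hε, hball⟩ := Metric.isOpen_iff.1 hrange.isOpen_compl Φ hΦr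
  have hdist : ∀ y, ε ≤ ‖Φ - J y‖ := fun y => by
    by_contra h
    exact hball (mem_ball'.2 ((dist_eq_norm Φ (J y)).trans_lt (not_le.1 h))) ⟨y, rfl⟩
  -- The bound ε/2 keeps Φ(φ n) above ε/2; the bound 1/(n+1) makes all approximation errors vanish
  -- in the limit.
  have hpos : ∀ n : ℕ, 0 < min (ε / 2) (1 / (n + 1 : ℝ)) := fun n => by positivity
  choose net hnetK hnet using fun (A : Finset (StrongDual ℝ E)) (n : ℕ) =>
    exists_finset_net hK A (hpos n)
  choose hel hel1 helε helD using fun (D : Finset E) (n : ℕ) =>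
    exists_small_functional hε.le hdist D (hpos n)
  -- The state before step n records the functionals φ i with i < n and the points chosen so far.
  -- Step n adds a net of K for those functionals, then a new functional φ n that is small on all
  -- recorded points, including the new ones.
  let s : ℕ → Finset (StrongDual ℝ E) × Finset E := fun n => Nat.rec (∅, ∅)
    (fun n p => (insert (hel (p.2 ∪ net p.1 n) n) p.1, p.2 ∪ net p.1 n)) n
  let φ : ℕ → StrongDual ℝ E := fun n => hel (s (n + 1)).2 n
  have hs1 : ∀ n, (s (n + 1)).1 = insert (φ n) (s n).1 := fun n => rfl
  have hs2 : ∀ n, (s (n + 1)).2 = (s n).2 ∪ net (s n).1 n := fun n => rfl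
  have hA : Monotone fun n => (s n).1 :=
    monotone_nat_of_le_succ fun n => by rw [hs1]; exact Finset.subset_insert _ _
  have hD : Monotone fun n => (s n).2 :=
    monotone_nat_of_le_succ fun n => by rw [hs2]; exact Finset.subset_union_left
  have hφA : ∀ {i n}, i < n → φ i ∈ (s n).1 := fun {i n} h =>
    hA (Nat.succ_le_of_lt h) (Finset.mem_insert_self (φ i) (s i).1)
  have htend : ∀ x ∈ K, Tendsto (fun n => φ n x) atTop (𝓝 0) := by
    intro x hx
    rw [tendsto_iff_ultrafilter]
    intro 𝒰 h𝒰
    obtain ⟨ψ, -, hψ⟩ := exists_tendsto_of_norm_le 𝒰 φ 1 (.of_forall fun n => hel1 _ _)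
    choose d hd hdx using fun n => hnet (s n).1 n x hx
    obtain ⟨z, hzK, hz⟩ := isCompact_image_toWeakSpace_iff.1 hK (𝒰.map d)
      (Ultrafilter.mem_map.2 (univ_mem' fun n => hnetK _ _ (hd n)))
    have h0 : Tendsto (fun n : ℕ => 1 / (n + 1 : ℝ)) 𝒰 (𝓝 0) :=
      tendsto_one_div_add_atTop_nhds_zero_nat.mono_left h𝒰
    -- A double limit argument: z, a weak limit of the net points d n, cannot be told from x by any
    -- φ i. The limit ψ of the φ n vanishes at each d n, hence at z, so lim φ n x = lim φ n z = ψ z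
    -- = 0.
    have hφz : ∀ i, φ i z = φ i x := fun i => by
      refine tendsto_nhds_unique (show Tendsto (fun n => φ i (d n)) 𝒰 _ from hz (φ i)) ?_
      rw [tendsto_iff_norm_sub_tendsto_zero]
      refine squeeze_zero' (.of_forall fun n => norm_nonneg _) ?_ h0
      filter_upwards [h𝒰 (eventually_gt_atTop i)] with n hn
      rw [norm_sub_rev]
      exact (hdx n _ (hφA hn)).le.trans (min_le_right _ _)
    have hψd : ∀ n, ψ (d n) = 0 := fun n => by
      refine tendsto_nhds_unique (hψ (d n)) ?_
      refine squeeze_zero_norm' ?_ h0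
      filter_upwards [h𝒰 (eventually_ge_atTop n)] with m hm
      refine (helD _ m _ (hD (Nat.succ_le_succ hm) ?_)).le.trans (min_le_right _ _)
      simp only [hs2]
      exact Finset.mem_union_right _ (hd n)
    have hψz : ψ z = 0 := tendsto_nhds_unique (show Tendsto (fun n => ψ (d n)) 𝒰 _ from hz ψ)
      (by simp [hψd])
    have := hψ z
    rw [hψz] at this
    simpa [hφz] using this
  have hlim := hΛ.tendsto_zero (g := fun n => restrictWeak K (φ n)) (r := r)
    (fun n => (norm_restrictWeak_le hr.le hKr _).trans
      (mul_le_of_le_one_right hr.le (hel1 _ _)))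
    (by rintro ⟨_, x, hx, rfl⟩; exact htend x hx)
  obtain ⟨n, hn⟩ := (hlim.eventually_lt_const (half_pos hε)).exists
  have := (abs_lt.1 (helε (s (n + 1)).2 n)).1
  have h2 := min_le_left (ε / 2) (1 / (n + 1 : ℝ))
  change Λ (restrictWeak K (hel (s (n + 1)).2 n)) < _ at hn
  rw [hΦ] at this
  linarith

/-- Krein's theorem: the convex hull of a weakly compact set is contained in a weakly compact
set. -/
theorem exists_isCompact_toWeakSpace_convexHull_subset [CompleteSpace E]
    (hK : IsCompact (toWeakSpace ℝ E '' K)) :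
    ∃ L : Set E, convexHull ℝ K ⊆ L ∧ IsCompact (toWeakSpace ℝ E '' L) := by
  have : CompactSpace (toWeakSpace ℝ E '' K) := isCompact_iff_compactSpace.1 hK
  refine ⟨{x | ∃ Λ : StrongDual ℝ C(toWeakSpace ℝ E '' K, ℝ), IsState Λ ∧
    ∀ φ, Λ (restrictWeak K φ) = φ x}, convexHull_min ?_ ?_, ?_⟩
  · intro x hx
    refine ⟨ContinuousMap.evalCLM ℝ ⟨toWeakSpace ℝ E x, mem_image_of_mem _ hx⟩,
      ⟨fun g hg => hg _, rfl⟩, fun φ => rfl⟩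
  · rintro x ⟨Λ, hΛ, hx⟩ y ⟨Λ', hΛ', hy⟩ a b ha hb hab
    refine ⟨a • Λ + b • Λ', ⟨fun g hg => ?_, ?_⟩, fun φ => ?_⟩
    · have := hΛ.1 g hg
      have := hΛ'.1 g hg
      simp only [add_apply, smul_apply, smul_eq_mul]
      positivity
    · simp [hΛ.2, hΛ'.2, hab]
    · simp [hx, hy]
  · refine isCompact_image_toWeakSpace_iff.2 fun 𝒰 h => ?_
    choose! Λ hΛ hφ using fun (x : E) (hx : x ∈ {x | ∃ Λ : StrongDual ℝ C(toWeakSpace ℝ E '' K, ℝ),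
      IsState Λ ∧ ∀ φ, Λ (restrictWeak K φ) = φ x}) => hx
    -- Compactness is inherited from the states: a limit of representing states is a state, and its
    -- barycenter is the required weak limit.
    obtain ⟨Λ₀, -, hΛ₀⟩ := exists_tendsto_of_norm_le 𝒰 Λ 1 (by
      filter_upwards [h] with x hx using (hΛ x hx).norm_le)
    have hst : IsState Λ₀ := by
      refine ⟨fun g hg => ge_of_tendsto (hΛ₀ g) ?_, tendsto_nhds_unique (hΛ₀ 1) ?_⟩
      · filter_upwards [h] with x hx using (hΛ x hx).1 g hg
      · refine tendsto_const_nhds.congr' ?_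
        filter_upwards [h] with x hx using (hΛ x hx).2.symm
    obtain ⟨x, hx⟩ := hst.exists_barycenter hK
    refine ⟨x, ⟨Λ₀, hst, hx⟩, fun φ => ?_⟩
    rw [← hx]
    refine (hΛ₀ (restrictWeak K φ)).congr' ?_
    filter_upwards [h] with y hy using hφ y hy φ

end Krein

noncomputable section

/-! ### A reflexivity criterion for spaces mapped into a Banach space -/

section Factorization

theorem exists_smul_norm_eq_one {Y : Type*} [NormedAddCommGroup Y] [NormedSpace ℝ Y] {y : Y}
    (hy : y ≠ 0) : ∃ c : ℝ, c • y ≠ 0 ∧ ‖c • y‖ = 1 := by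
  have hn := norm_ne_zero_iff.2 hy
  exact ⟨‖y‖⁻¹, smul_ne_zero (inv_ne_zero hn) hy, by
    rw [norm_smul, norm_inv, norm_norm, inv_mul_cancel₀ hn]⟩

theorem exists_eq_smul_of_norm_le_one {Y : Type*} [NormedAddCommGroup Y] [NormedSpace ℝ Y]
    (y : Y) : ∃ (c : ℝ) (z : Y), ‖z‖ ≤ 1 ∧ c • z = y := by
  refine ⟨‖y‖ + 1, (‖y‖ + 1)⁻¹ • y, ?_, ?_⟩
  · rw [norm_smul, norm_inv, Real.norm_of_nonneg (by positivity), inv_mul_le_iff₀ (by positivity)]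
    linarith
  · rw [smul_smul, mul_inv_cancel₀ (by positivity), one_smul]

theorem IsClosed.mem_of_forall_norm_sub_le {Y : Type*} [NormedAddCommGroup Y] {s : Set Y}
    (hs : IsClosed s) {y : Y} (h : ∀ ε > 0, ∃ z ∈ s, ‖y - z‖ ≤ ε) : y ∈ s := by
  rw [← hs.closure_eq, Metric.mem_closure_iff]
  intro ε hε
  obtain ⟨z, hz, hyz⟩ := h (ε / 2) (half_pos hε)
  exact ⟨z, hz, by rw [dist_eq_norm]; linarith⟩

variable {E V : Type*} [NormedAddCommGroup E] [NormedSpace ℝ E] [NormedAddCommGroup V]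
  [NormedSpace ℝ V]

/-- A functional on the dual of `V` which vanishes on the functionals coming from `E` is zero,
if vectors of the unit ball of `V` which are small in `E` are nearly orthogonal to any given vector
of the ball. -/
theorem eq_zero_of_forall_comp_eq_zero (j : V →L[ℝ] E)
    (hadd : ∀ v, ‖v‖ ≤ 1 → ∀ δ > 0, ∃ η > 0, ∀ w, ‖w‖ ≤ 1 → ‖j w‖ < η →
      ‖v + w‖ ^ 2 ≤ 2 + 2 * δ) (Φ : StrongDual ℝ (StrongDual ℝ V))
    (h : ∀ φ : StrongDual ℝ E, Φ (φ.comp j) = 0) : Φ = 0 := by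
  by_contra hΦ
  wlog h1 : ‖Φ‖ = 1 generalizing Φ
  · obtain ⟨c, hc0, hc⟩ := exists_smul_norm_eq_one (y := Φ) fun h0 => hΦ h0
    exact this (c • Φ) (fun φ => by simp [h]) (fun h0 => hc0 h0) hc
  -- The values 0.9 and 0.1 clash at the end: ‖v + w‖ ≥ ψ(v + w) > 1.8, whereas ‖v + w‖² ≤ 2 + 2 ·
  -- 0.1.
  obtain ⟨ψ, hψ, hΦψ⟩ := ContinuousLinearMap.exists_lt_apply_of_lt_opNorm Φ
    (r := 0.9) (by rw [h1]; norm_num)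
  wlog hpos : 0 ≤ Φ ψ generalizing ψ
  · exact this (-ψ) (by simpa using hψ) (by simpa using hΦψ)
      (by rw [map_neg]; linarith)
  rw [Real.norm_of_nonneg hpos] at hΦψ
  obtain ⟨𝒰, h𝒰, hlim⟩ := exists_ultrafilter_tendsto_bidual Φ h1.le
  have hev := (hlim ψ).eventually_const_lt hΦψ
  obtain ⟨v, hv, hψv⟩ := (Eventually.and (p := (· ∈ closedBall 0 1)) h𝒰 hev).exists
  rw [mem_closedBall_zero_iff] at hv
  obtain ⟨η, hη, hw⟩ := hadd v hv 0.1 (by norm_num)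
  set Q : Set V := closedBall 0 1 ∩ {w | 0.9 < ψ w}
  have hQ : Convex ℝ Q := (convex_closedBall 0 1).inter
    (convex_halfSpace_gt ψ.isLinear _)
  -- Along the Goldstine ultrafilter j tends weakly to 0, since Φ kills every φ ∘ j. Convexity of Q
  -- upgrades this to norm closure.
  have h0 : (0 : E) ∈ closure (j '' Q) := by
    refine mem_of_forall_tendsto (l := (𝒰 : Filter V)) (z := j)
      (hQ.linear_image j.toLinearMap).closure isClosed_closure ?_ fun φ => ?_
    · filter_upwards [h𝒰, hev] with w hw1 hw2
      exact subset_closure ⟨w, ⟨hw1, hw2⟩, rfl⟩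
    · rw [map_zero, ← h φ]
      exact hlim (φ.comp j)
  obtain ⟨_, ⟨w, ⟨hw1, hψw⟩, rfl⟩, hdist⟩ := Metric.mem_closure_iff.1 h0 η hη
  have h2 := hw w (by simpa using hw1) (by simpa using hdist)
  have h3 : ψ (v + w) ≤ ‖v + w‖ := (Real.le_norm_self _).trans
    ((ψ.le_of_opNorm_le hψ.le _).trans (by rw [one_mul]))
  rw [map_add] at h3
  have h4 : (0.9 : ℝ) < ψ w := hψw
  nlinarith [norm_nonneg (v + w)]

/-- The factorization criterion of Davis, Figiel, Johnson and Pełczyński for reflexivity. -/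
theorem isReflexiveSpace_of_isClosed_image [CompleteSpace E] (j : V →L[ℝ] E)
    (hj : IsClosed (j '' closedBall 0 1))
    (hadd : ∀ v, ‖v‖ ≤ 1 → ∀ δ > 0, ∃ η > 0, ∀ w, ‖w‖ ≤ 1 → ‖j w‖ < η →
      ‖v + w‖ ^ 2 ≤ 2 + 2 * δ) (hP : ∀ ε > 0, ∃ K : Set E,
    IsCompact (toWeakSpace ℝ E '' K) ∧ ∀ v : V, ‖v‖ ≤ 1 → ∃ k ∈ K, ‖j v - k‖ ≤ ε) :
    IsReflexiveSpace V := by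
  suffices H : ∀ Φ : StrongDual ℝ (StrongDual ℝ V), ‖Φ‖ ≤ 1 →
      ∃ v, NormedSpace.inclusionInDoubleDual ℝ V v = Φ by
    intro Φ
    obtain ⟨c, Φ', hΦ', rfl⟩ := exists_eq_smul_of_norm_le_one Φ
    obtain ⟨v, rfl⟩ := H Φ' hΦ'
    exact ⟨c • v, map_smul _ c v⟩
  intro Φ hΦ
  obtain ⟨𝒰, h𝒰, hlim⟩ := exists_ultrafilter_tendsto_bidual Φ hΦ
  set J := NormedSpace.inclusionInDoubleDual ℝ E
  set Ψ : StrongDual ℝ (StrongDual ℝ E) :=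
    Φ.comp ((ContinuousLinearMap.compL ℝ V E ℝ).flip j)
  have hΨ : ∀ φ, Tendsto (fun v => φ (j v)) 𝒰 (𝓝 (Ψ φ)) := fun φ => hlim (φ.comp j)
  have hrange : IsClosed (range J) :=
    ((NormedSpace.inclusionInDoubleDualLi (E := E) ℝ).isometry.isUniformInducing.isComplete_range
      :).isClosed
  -- The second adjoint image of Φ is within ε of a weak limit of points of K, so it lies in the
  -- closed subspace E of the bidual.
  have hmem : Ψ ∈ range J := by
    refine hrange.mem_of_forall_norm_sub_le fun ε hε => ?_
    obtain ⟨K, hK, hKv⟩ := hP ε hε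
    choose! k hk hkv using hKv
    obtain ⟨z, hzK, hz⟩ := isCompact_image_toWeakSpace_iff.1 hK (𝒰.map k) (Ultrafilter.mem_map.2 (by
      filter_upwards [h𝒰] with v hv using hk v (by simpa using hv)))
    refine ⟨J z, mem_range_self z, ?_⟩
    refine ContinuousLinearMap.opNorm_le_bound _ hε.le fun φ => ?_
    have ht : Tendsto (fun v => ‖φ (j v) - φ (k v)‖) 𝒰 (𝓝 ‖(Ψ - J z) φ‖) :=
      ((hΨ φ).sub (hz φ)).norm
    refine le_of_tendsto ht ?_
    filter_upwards [h𝒰] with v hv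
    rw [← map_sub, mul_comm]
    exact φ.le_of_opNorm_le_of_le le_rfl (hkv v (by simpa using hv))
  obtain ⟨e, he⟩ := hmem
  have hΨe : ∀ φ, Ψ φ = φ e := fun φ => by rw [← he]; rfl
  have hball : e ∈ j '' closedBall 0 1 := by
    refine mem_of_forall_tendsto (l := (𝒰 : Filter V)) (z := j)
      ((convex_closedBall 0 1).linear_image j.toLinearMap)
      hj ?_ fun φ => ?_
    · filter_upwards [h𝒰] with v hv using mem_image_of_mem _ hv
    · rw [← hΨe]; exact hΨ φ
  obtain ⟨v, -, rfl⟩ := hball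
  refine ⟨v, (sub_eq_zero.1 (eq_zero_of_forall_comp_eq_zero j hadd
    (Φ - NormedSpace.inclusionInDoubleDual ℝ V v) fun φ => ?_)).symm⟩
  exact sub_eq_zero.2 (hΨe φ)

end Factorization

/-! ### The square-summable space of a sequence of seminorms -/

/-- A sequence of continuous seminorms on `E`, the first of which dominates the norm. -/
structure NormScale (E : Type*) [NormedAddCommGroup E] [NormedSpace ℝ E] where
  p : ℕ → Seminorm ℝ E
  bound : ∀ n, ∃ c, ∀ x, p n x ≤ c * ‖x‖
  norm_le : ∀ x, ‖x‖ ≤ p 0 x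

namespace NormScale

variable {E : Type*} [NormedAddCommGroup E] [NormedSpace ℝ E] (P : NormScale E)

theorem continuous (n : ℕ) : Continuous (P.p n) := by
  obtain ⟨c, hc⟩ := P.bound n
  refine Seminorm.continuous_of_continuousAt_zero ?_
  rw [ContinuousAt, map_zero]
  refine squeeze_zero (fun x => apply_nonneg _ _) hc ?_
  simpa using (tendsto_norm_zero (E := E)).const_mul c

/-- The vectors of `E` at which the sequence of seminorms is square summable. -/
def carrier : Submodule ℝ E where
  carrier := {x | Summable fun n => P.p n x ^ 2}
  zero_mem' := by simp
  add_mem' := fun {x y} hx hy => by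
    refine Summable.of_nonneg_of_le (fun n => sq_nonneg _) (fun n => ?_)
      ((hx.add hy).mul_left 2)
    have h := map_add_le_add (P.p n) x y
    have h0 := apply_nonneg (P.p n) (x + y)
    nlinarith [sq_nonneg (P.p n x - P.p n y)]
  smul_mem' := fun c x hx => by
    refine (hx.mul_left (‖c‖ ^ 2)).congr fun n => ?_
    rw [map_smul_eq_mul, mul_pow]

/-- The space of vectors at which the sequence of seminorms is square summable, with the norm
given by the square root of the sum of the squares of the seminorms. -/
def Space : Type _ := P.carrier

instance : AddCommGroup P.Space := inferInstanceAs (AddCommGroup P.carrier)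

instance : Module ℝ P.Space := inferInstanceAs (Module ℝ P.carrier)

/-- The inclusion as a linear map. -/
def inclₗ : P.Space →ₗ[ℝ] E := P.carrier.subtype

theorem inclₗ_injective : Function.Injective P.inclₗ := P.carrier.subtype_injective

theorem summable (v : P.Space) : Summable fun n => P.p n (P.inclₗ v) ^ 2 := v.2

instance : Norm P.Space := ⟨fun v => √(∑' n, P.p n (P.inclₗ v) ^ 2)⟩

theorem norm_sq (v : P.Space) : ‖v‖ ^ 2 = ∑' n, P.p n (P.inclₗ v) ^ 2 :=
  Real.sq_sqrt (tsum_nonneg fun _ => sq_nonneg _)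

theorem norm_nonneg' (v : P.Space) : 0 ≤ ‖v‖ := Real.sqrt_nonneg _

theorem sum_le_norm_sq (v : P.Space) (s : Finset ℕ) :
    ∑ n ∈ s, P.p n (P.inclₗ v) ^ 2 ≤ ‖v‖ ^ 2 := by
  rw [norm_sq]
  exact (P.summable v).sum_le_tsum s fun _ _ => sq_nonneg _

theorem norm_le_of_sum_le {v : P.Space} {r : ℝ} (hr : 0 ≤ r)
    (h : ∀ N, ∑ n ∈ Finset.range N, P.p n (P.inclₗ v) ^ 2 ≤ r ^ 2) : ‖v‖ ≤ r := by
  refine (sq_le_sq₀ (P.norm_nonneg' v) hr).1 ?_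
  rw [norm_sq]
  exact (P.summable v).tsum_le_of_sum_range_le h

theorem p_le_norm (v : P.Space) (n : ℕ) : P.p n (P.inclₗ v) ≤ ‖v‖ :=
  (sq_le_sq₀ (apply_nonneg _ _) (P.norm_nonneg' v)).1 (by simpa using P.sum_le_norm_sq v {n})

theorem norm_inclₗ_le (v : P.Space) : ‖P.inclₗ v‖ ≤ ‖v‖ :=
  (P.norm_le _).trans (P.p_le_norm v 0)

theorem core : NormedSpace.Core ℝ P.Space where
  norm_nonneg := P.norm_nonneg'
  norm_smul c v := by
    have h : ‖c • v‖ ^ 2 = (‖c‖ * ‖v‖) ^ 2 := by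
      rw [mul_pow, norm_sq, norm_sq, ← tsum_mul_left]
      exact tsum_congr fun n => by rw [map_smul, map_smul_eq_mul, mul_pow]
    exact (pow_left_inj₀ (P.norm_nonneg' _) (mul_nonneg (norm_nonneg c) (P.norm_nonneg' v))
      two_ne_zero).1 h
  norm_triangle v w := by
    have hv := P.norm_nonneg' v
    have hw := P.norm_nonneg' w
    refine P.norm_le_of_sum_le (add_nonneg hv hw) fun N => ?_
    have hCS : ∑ n ∈ Finset.range N, P.p n (P.inclₗ v) * P.p n (P.inclₗ w) ≤ ‖v‖ * ‖w‖ := by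
      refine (Real.sum_mul_le_sqrt_mul_sqrt _ _ _).trans ?_
      refine mul_le_mul ?_ ?_ (Real.sqrt_nonneg _) hv
      · exact (Real.sqrt_le_left hv).2 (P.sum_le_norm_sq v _)
      · exact (Real.sqrt_le_left hw).2 (P.sum_le_norm_sq w _)
    calc ∑ n ∈ Finset.range N, P.p n (P.inclₗ (v + w)) ^ 2
        ≤ ∑ n ∈ Finset.range N, (P.p n (P.inclₗ v) ^ 2 + P.p n (P.inclₗ w) ^ 2 +
            2 * (P.p n (P.inclₗ v) * P.p n (P.inclₗ w))) := by
          refine Finset.sum_le_sum fun n _ => ?_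
          rw [map_add]
          have h := map_add_le_add (P.p n) (P.inclₗ v) (P.inclₗ w)
          have h0 := apply_nonneg (P.p n) (P.inclₗ v + P.inclₗ w)
          calc _ ≤ (P.p n (P.inclₗ v) + P.p n (P.inclₗ w)) ^ 2 := pow_le_pow_left₀ h0 h 2
            _ = _ := by ring
      _ ≤ ‖v‖ ^ 2 + ‖w‖ ^ 2 + 2 * (‖v‖ * ‖w‖) := by
          rw [Finset.sum_add_distrib, Finset.sum_add_distrib, ← Finset.mul_sum]
          have h1 := P.sum_le_norm_sq v (Finset.range N)
          have h2 := P.sum_le_norm_sq w (Finset.range N)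
          linarith
      _ = (‖v‖ + ‖w‖) ^ 2 := by ring
  norm_eq_zero_iff v := by
    constructor
    · intro h
      have := P.norm_inclₗ_le v
      rw [h] at this
      exact P.inclₗ_injective (by rw [map_zero]; exact norm_le_zero_iff.1 this)
    · rintro rfl
      change √_ = 0
      simp

instance : NormedAddCommGroup P.Space := NormedAddCommGroup.ofCore P.core

instance : NormedSpace ℝ P.Space := NormedSpace.ofCore P.core

/-- The inclusion as a continuous linear map. -/
def incl : P.Space →L[ℝ] E := P.inclₗ.mkContinuous 1 fun v => by
  rw [one_mul]; exact P.norm_inclₗ_le v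

theorem inclₗ_eq (v : P.Space) : P.inclₗ v = P.incl v := rfl

theorem incl_injective : Function.Injective P.incl := P.inclₗ_injective

theorem exists_incl_eq {x : E} (hx : Summable fun n => P.p n x ^ 2) : ∃ v, P.incl v = x :=
  ⟨⟨x, hx⟩, rfl⟩

theorem mem_image_closedBall_iff {x : E} {r : ℝ} (hr : 0 ≤ r) : x ∈ P.incl '' closedBall 0 r ↔
    ∀ N, ∑ n ∈ Finset.range N, P.p n x ^ 2 ≤ r ^ 2 := by
  constructor
  · rintro ⟨v, hv, rfl⟩ N
    refine (P.sum_le_norm_sq v _).trans (pow_le_pow_left₀ (norm_nonneg _) ?_ 2)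
    simpa using hv
  · intro h
    obtain ⟨v, rfl⟩ := P.exists_incl_eq (summable_of_sum_range_le (fun n => sq_nonneg _) h)
    exact ⟨v, mem_closedBall_zero_iff.2 (P.norm_le_of_sum_le hr h), rfl⟩

/-- Bounding every finite partial sum, rather than the full series, expresses the ball through
closed conditions on E. -/
theorem isClosed_image_closedBall {r : ℝ} (hr : 0 ≤ r) : IsClosed (P.incl '' closedBall 0 r) := by
  have : P.incl '' closedBall 0 r =
      ⋂ N, {x | ∑ n ∈ Finset.range N, P.p n x ^ 2 ≤ r ^ 2} := by
    ext x
    rw [P.mem_image_closedBall_iff hr]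
    simp
  rw [this]
  exact isClosed_iInter fun N => isClosed_le
    (continuous_finsetSum _ fun n _ => (P.continuous n).pow 2) continuous_const

instance [CompleteSpace E] : CompleteSpace P.Space := by
  refine Metric.complete_of_cauchySeq_tendsto fun u hu => ?_
  obtain ⟨x, hx⟩ := cauchySeq_tendsto_of_complete
    (hu.map P.incl.uniformContinuous : CauchySeq fun k => P.incl (u k))
  -- The differences u k - u m lie in the ε-ball, whose image is closed in E, so letting m tend to
  -- infinity in E keeps the limit in that image.
  have key : ∀ ε > 0, ∃ M, ∀ k ≥ M, ∃ v : P.Space, ‖v‖ ≤ ε ∧ P.incl v = P.incl (u k) - x := by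
    intro ε hε
    obtain ⟨M, hM⟩ := Metric.cauchySeq_iff.1 hu ε hε
    refine ⟨M, fun k hk => ?_⟩
    have hmem : P.incl (u k) - x ∈ P.incl '' closedBall 0 ε := by
      refine (P.isClosed_image_closedBall hε.le).mem_of_tendsto (tendsto_const_nhds.sub hx) ?_
      filter_upwards [eventually_ge_atTop M] with m hm
      refine ⟨u k - u m, ?_, map_sub _ _ _⟩
      rw [mem_closedBall_zero_iff, ← dist_eq_norm]
      exact (hM k hk m hm).le
    obtain ⟨v, hv, hvx⟩ := hmem
    exact ⟨v, by simpa using hv, hvx⟩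
  obtain ⟨M, hM⟩ := key 1 one_pos
  obtain ⟨v, -, hv⟩ := hM M le_rfl
  have hxw : P.incl (u M - v) = x := by rw [map_sub, hv]; abel
  refine ⟨u M - v, Metric.tendsto_atTop.2 fun ε hε => ?_⟩
  obtain ⟨L, hL⟩ := key (ε / 2) (half_pos hε)
  refine ⟨L, fun k hk => ?_⟩
  obtain ⟨w, hw, hwx⟩ := hL k hk
  have : w = u k - (u M - v) := P.incl_injective (by rw [hwx, map_sub _ (u k), hxw])
  rw [dist_eq_norm, ← this]
  linarith

/-- The square of the norm of a sum, when the scalar product of the sequences of seminorms is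
small. -/
theorem norm_add_sq_le {v w : P.Space} {δ : ℝ} (h : ∀ N, ∑ n ∈ Finset.range N,
    P.p n (P.incl v) * P.p n (P.incl w) ≤ δ) : ‖v + w‖ ^ 2 ≤ ‖v‖ ^ 2 + ‖w‖ ^ 2 + 2 * δ := by
  rw [norm_sq]
  refine (P.summable (v + w)).tsum_le_of_sum_range_le fun N => ?_
  have h1 := P.sum_le_norm_sq v (Finset.range N)
  have h2 := P.sum_le_norm_sq w (Finset.range N)
  have h3 := h N
  calc ∑ n ∈ Finset.range N, P.p n (P.inclₗ (v + w)) ^ 2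
      ≤ ∑ n ∈ Finset.range N, (P.p n (P.inclₗ v) ^ 2 + P.p n (P.inclₗ w) ^ 2 +
          2 * (P.p n (P.incl v) * P.p n (P.incl w))) := by
        refine Finset.sum_le_sum fun n _ => ?_
        rw [map_add]
        have h := map_add_le_add (P.p n) (P.inclₗ v) (P.inclₗ w)
        have h0 := apply_nonneg (P.p n) (P.inclₗ v + P.inclₗ w)
        calc _ ≤ (P.p n (P.inclₗ v) + P.p n (P.inclₗ w)) ^ 2 := pow_le_pow_left₀ h0 h 2
          _ = _ := by rw [← inclₗ_eq, ← inclₗ_eq]; ring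
    _ ≤ _ := by
        rw [Finset.sum_add_distrib, Finset.sum_add_distrib, ← Finset.mul_sum]
        linarith

/-- Given `v` of norm at most `1`, every `w` of norm at most `1` which is small enough in `E` is
nearly orthogonal to `v`. -/
theorem exists_forall_norm_add_sq_le {v : P.Space} (hv : ‖v‖ ≤ 1) {δ : ℝ} (hδ : 0 < δ) :
    ∃ η > 0, ∀ w : P.Space, ‖w‖ ≤ 1 → ‖P.incl w‖ < η → ‖v + w‖ ^ 2 ≤ 2 + 2 * δ := by
  -- Off the finite set s, v has square sum below (δ/2)², and Cauchy–Schwarz gives δ/2. On s, p_n(v)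
  -- ≤ 1, and a w small in E makes the finite sum of the p_n(w) smaller than δ/2.
  obtain ⟨s, hs⟩ := ((summable_iff_vanishing_norm).1 (P.summable v)) (δ ^ 2 / 4) (by positivity)
  have hcont : Continuous fun x => ∑ n ∈ s, P.p n x :=
    continuous_finsetSum _ fun n _ => P.continuous n
  have h0 : ∀ᶠ x in 𝓝 (0 : E), ∑ n ∈ s, P.p n x < δ / 2 :=
    (hcont.tendsto 0).eventually_lt_const (by simpa using half_pos hδ)
  obtain ⟨η, hη, hball⟩ := Metric.eventually_nhds_iff.1 h0
  refine ⟨η, hη, fun w hw hwη => ?_⟩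
  have hsw := hball (y := P.incl w) (by simpa using hwη)
  have key : ∀ M, ∑ n ∈ Finset.range M, P.p n (P.incl v) * P.p n (P.incl w) ≤ δ := fun M => by
    classical
    rw [← Finset.sum_filter_add_sum_filter_not (Finset.range M) (· ∈ s)]
    have h1 : ∑ n ∈ Finset.range M with n ∈ s, P.p n (P.incl v) * P.p n (P.incl w) ≤ δ / 2 := by
      refine le_trans ?_ hsw.le
      calc _ ≤ ∑ n ∈ Finset.range M with n ∈ s, P.p n (P.incl w) :=
            Finset.sum_le_sum fun n _ => mul_le_of_le_one_left (apply_nonneg _ _)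
              ((P.p_le_norm v n).trans hv)
        _ ≤ _ := Finset.sum_le_sum_of_subset_of_nonneg
            (fun n hn => (Finset.mem_filter.1 hn).2) fun _ _ _ => apply_nonneg _ _
    have h2 : ∑ n ∈ Finset.range M with n ∉ s, P.p n (P.incl v) * P.p n (P.incl w) ≤ δ / 2 := by
      set t := {n ∈ Finset.range M | n ∉ s}
      refine (Real.sum_mul_le_sqrt_mul_sqrt _ _ _).trans ?_
      have ht := hs t (Finset.disjoint_left.2 fun n hn => (Finset.mem_filter.1 hn).2)
      calc _ ≤ δ / 2 * 1 := by
            refine mul_le_mul ?_ ?_ (Real.sqrt_nonneg _) (by positivity)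
            · refine (Real.sqrt_le_left (by positivity)).2 ((Real.le_norm_self _).trans ?_)
              exact ht.le.trans (by ring_nf; rfl)
            · refine (Real.sqrt_le_left zero_le_one).2 ((P.sum_le_norm_sq w _).trans ?_)
              exact pow_le_pow_left₀ (norm_nonneg w) hw 2
        _ = δ / 2 := mul_one _
    linarith
  have := P.norm_add_sq_le key
  have h1 : ‖v‖ ^ 2 ≤ 1 := pow_le_one₀ (norm_nonneg v) hv
  have h2 : ‖w‖ ^ 2 ≤ 1 := pow_le_one₀ (norm_nonneg w) hw
  linarith

/-- The space is reflexive if the image of its unit ball is approximated by weakly compact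
sets. -/
theorem isReflexiveSpace [CompleteSpace E] (hP : ∀ ε > 0, ∃ K : Set E,
    IsCompact (toWeakSpace ℝ E '' K) ∧ ∀ v : P.Space, ‖v‖ ≤ 1 → ∃ k ∈ K, ‖P.incl v - k‖ ≤ ε) :
    IsReflexiveSpace P.Space :=
  isReflexiveSpace_of_isClosed_image P.incl (P.isClosed_image_closedBall zero_le_one)
    (fun _ hv _ hδ => P.exists_forall_norm_add_sq_le hv hδ) hP

/-- The operator induced by an operator on `E` which is contractive for all the seminorms. -/
def map (T : E →L[ℝ] E) (hT : ∀ n x, P.p n (T x) ≤ P.p n x) : P.Space →L[ℝ] P.Space :=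
  LinearMap.mkContinuous
    (T.toLinearMap.restrict (p := P.carrier) (q := P.carrier) fun x (hx : Summable _) =>
      show Summable _ from hx.of_nonneg_of_le (fun n => sq_nonneg _)
        fun n => pow_le_pow_left₀ (apply_nonneg _ _) (hT n x) 2) 1 fun v => by
    rw [one_mul]
    refine P.norm_le_of_sum_le (norm_nonneg v) fun N => ?_
    refine le_trans (Finset.sum_le_sum fun n _ => ?_) (P.sum_le_norm_sq v (Finset.range N))
    exact pow_le_pow_left₀ (apply_nonneg _ _) (hT n (P.inclₗ v)) 2

theorem incl_map (T : E →L[ℝ] E) (hT : ∀ n x, P.p n (T x) ≤ P.p n x) (v : P.Space) :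
    P.incl (P.map T hT v) = T (P.incl v) := rfl

theorem norm_map_le (T : E →L[ℝ] E) (hT : ∀ n x, P.p n (T x) ≤ P.p n x) : ‖P.map T hT‖ ≤ 1 :=
  LinearMap.mkContinuous_norm_le _ zero_le_one _

/-- Contractivity for each seminorm bounds the terms of the squared norm of a difference by 4
p_n(v)², uniformly in s. Termwise continuity then passes to the sum. -/
theorem continuous_map {S : Type*} [TopologicalSpace S] (T : S → E →L[ℝ] E)
    (hT : ∀ s n x, P.p n (T s x) ≤ P.p n x) (v : P.Space)
    (hc : Continuous fun s => T s (P.incl v)) : Continuous fun s => P.map (T s) (hT s) v := by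
  refine continuous_iff_continuousAt.2 fun s₀ => ?_
  have hsq : Continuous fun s => ‖P.map (T s) (hT s) v - P.map (T s₀) (hT s₀) v‖ ^ 2 := by
    simp only [norm_sq]
    refine continuous_tsum (u := fun n => 4 * P.p n (P.incl v) ^ 2)
      (fun n => ((P.continuous n).comp (hc.sub continuous_const)).pow 2)
      ((P.summable v).mul_left 4) fun n s => ?_
    rw [map_sub, Real.norm_of_nonneg (sq_nonneg _)]
    have h := map_sub_le_add (P.p n) (P.incl (P.map (T s) (hT s) v))
      (P.incl (P.map (T s₀) (hT s₀) v))
    have h1 := hT s n (P.incl v)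
    have h2 := hT s₀ n (P.incl v)
    calc _ ≤ (2 * P.p n (P.incl v)) ^ 2 :=
          pow_le_pow_left₀ (apply_nonneg _ _) (h.trans (by rw [incl_map, incl_map]; linarith)) 2
      _ = _ := by ring
  refine tendsto_iff_norm_sub_tendsto_zero.2 ?_
  have := (Real.continuous_sqrt.comp hsq).tendsto s₀
  simpa [Function.comp_def, Real.sqrt_sq] using this

end NormScale

end

/-! ### Interpolation between a weakly precompact set and the unit ball -/

section Interpolation

open scoped Pointwise

variable {E : Type*} [NormedAddCommGroup E] [NormedSpace ℝ E] {W : Set E}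

theorem isCompact_toWeakSpace_image_clm {F : Type*} [NormedAddCommGroup F] [NormedSpace ℝ F]
    (A : E →L[ℝ] F) {K : Set E} (hK : IsCompact (toWeakSpace ℝ E '' K)) :
    IsCompact (toWeakSpace ℝ F '' (A '' K)) := by
  have := hK.image (WeakSpace.map A).continuous
  rw [image_image] at this ⊢
  exact this

/-- The unit balls of the interpolating norms of Davis, Figiel, Johnson and Pełczyński. -/
def interpolationBall (W : Set E) (n : ℕ) : Set E :=
  (2 : ℝ) ^ n • W + closedBall 0 ((1 / 2 : ℝ) ^ (n + 1))

theorem mem_interpolationBall {n : ℕ} {x : E} : x ∈ interpolationBall W n ↔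
    ∃ w ∈ W, ‖x - (2 : ℝ) ^ n • w‖ ≤ (1 / 2 : ℝ) ^ (n + 1) := by
  constructor
  · rintro ⟨_, ⟨w, hw, rfl⟩, b, hb, rfl⟩
    exact ⟨w, hw, by simpa using hb⟩
  · rintro ⟨w, hw, h⟩
    exact ⟨_, ⟨w, hw, rfl⟩, x - (2 : ℝ) ^ n • w, by simpa using h, by simp⟩

theorem closedBall_subset_interpolationBall (h0 : (0 : E) ∈ W) (n : ℕ) :
    closedBall 0 ((1 / 2 : ℝ) ^ (n + 1)) ⊆ interpolationBall W n := fun x hx =>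
  mem_interpolationBall.2 ⟨0, h0, by simpa using hx⟩

theorem balanced_interpolationBall (hW : AbsConvex ℝ W) (n : ℕ) :
    Balanced ℝ (interpolationBall W n) :=
  (hW.1.smul _).add balanced_closedBall_zero

theorem convex_interpolationBall (hW : AbsConvex ℝ W) (n : ℕ) :
    Convex ℝ (interpolationBall W n) :=
  (hW.2.smul _).add (convex_closedBall _ _)

theorem absorbent_interpolationBall (h0 : (0 : E) ∈ W) (n : ℕ) :
    Absorbent ℝ (interpolationBall W n) :=
  absorbent_nhds_zero (mem_of_superset (closedBall_mem_nhds 0 (by positivity))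
    (closedBall_subset_interpolationBall h0 n))

/-- The norms interpolating between the gauge of `W` and the norm of `E`. -/
noncomputable def interpolationScale (hW : AbsConvex ℝ W) (h0 : (0 : E) ∈ W)
    (hball : W ⊆ closedBall 0 (1 / 2)) : NormScale E where
  p n := gaugeSeminorm (balanced_interpolationBall hW n) (convex_interpolationBall hW n)
    (absorbent_interpolationBall h0 n)
  bound n := by
    refine ⟨((1 / 2 : ℝ) ^ (n + 1))⁻¹, fun x => ?_⟩
    rw [le_inv_mul_iff₀ (by positivity)]
    exact mul_gauge_le_norm (ball_subset_closedBall.trans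
      (closedBall_subset_interpolationBall h0 n))
  norm_le x := by
    -- At n = 0 the ball is W plus the ball of radius 1/2; with W also inside that ball, the sum
    -- lies in the unit ball.
    have hs : interpolationBall W 0 ⊆ closedBall 0 1 := fun y hy => by
      obtain ⟨w, hw, h⟩ := mem_interpolationBall.1 hy
      have := hball hw
      simp only [mem_closedBall_zero_iff, pow_zero, one_smul, zero_add, pow_one] at this h ⊢
      linarith [norm_le_norm_add_norm_sub' y w]
    simpa using le_gauge_of_subset_closedBall (absorbent_interpolationBall h0 0) zero_le_one hs
      (x := x)

variable (hW : AbsConvex ℝ W) (h0 : (0 : E) ∈ W) (hball : W ⊆ closedBall 0 (1 / 2))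

/-- Since 2^n x lies in 2^n W, the n-th gauge of x is at most 2^(-n), which is square summable. -/
theorem exists_incl_interpolationScale_eq {x : E} (hx : x ∈ W) :
    ∃ v, (interpolationScale hW h0 hball).incl v = x := by
  have hp : ∀ n, (interpolationScale hW h0 hball).p n x ≤ (1 / 2 : ℝ) ^ n := fun n => by
    refine gauge_le_of_mem (by positivity) ⟨(2 : ℝ) ^ n • x, mem_interpolationBall.2
      ⟨x, hx, by simp⟩, ?_⟩
    simp [smul_smul]
  refine NormScale.exists_incl_eq _ (Summable.of_nonneg_of_le (fun n => sq_nonneg _) (fun n =>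
    pow_le_pow_left₀ (apply_nonneg _ _) (hp n) 2) ?_)
  simp only [← pow_mul, mul_comm _ 2]
  simp only [pow_mul]
  exact summable_geometric_of_lt_one (by norm_num) (by norm_num)

theorem isReflexiveSpace_interpolationScale [CompleteSpace E] {L : Set E} (hWL : W ⊆ L)
    (hL : IsCompact (toWeakSpace ℝ E '' L)) :
    IsReflexiveSpace (interpolationScale hW h0 hball).Space := by
  refine NormScale.isReflexiveSpace _ fun ε hε => ?_
  obtain ⟨n, hn⟩ := exists_pow_lt_of_lt_one hε (show (1 / 2 : ℝ) < 1 by norm_num)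
  refine ⟨_, isCompact_toWeakSpace_image_clm ((2 : ℝ) ^ (n + 1) • ContinuousLinearMap.id ℝ E) hL,
    fun v hv => ?_⟩
  -- The slack from 1 to 2 yields a factor b < 2 without asking that the gauge be attained. It costs
  -- one power of two: the approximating set is 2^(n+1) L and the error is 2 · 2^(-n-1) = 2^(-n).
  have h1 : gauge (interpolationBall W n) ((interpolationScale hW h0 hball).incl v) < 2 :=
    lt_of_le_of_lt ((NormScale.p_le_norm _ v n).trans hv) one_lt_two
  obtain ⟨b, hb, hb2, y, hy, hyv⟩ := exists_lt_of_gauge_lt (absorbent_interpolationBall h0 n) h1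
  obtain ⟨w, hw, hyw⟩ := mem_interpolationBall.1 hy
  have hbw : (b / 2) • w ∈ W := hW.1.smul_mem
    (by rw [Real.norm_of_nonneg (by positivity)]; linarith) hw
  refine ⟨_, ⟨_, hWL hbw, rfl⟩, ?_⟩
  have : (interpolationScale hW h0 hball).incl v -
      ((2 : ℝ) ^ (n + 1) • ContinuousLinearMap.id ℝ E) ((b / 2) • w) =
      b • (y - (2 : ℝ) ^ n • w) := by
    rw [← hyv]
    simp only [smul_apply, ContinuousLinearMap.id_apply, smul_smul, smul_sub]
    congr 2
    ring
  rw [this, norm_smul, Real.norm_of_nonneg hb.le]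
  calc b * ‖y - (2 : ℝ) ^ n • w‖ ≤ 2 * (1 / 2 : ℝ) ^ (n + 1) :=
        mul_le_mul hb2.le hyw (norm_nonneg _) zero_le_two
    _ = (1 / 2 : ℝ) ^ n := by ring
    _ ≤ ε := hn.le

theorem interpolationScale_p_apply_le {T : E →L[ℝ] E} (hT : ‖T‖ ≤ 1) (hTW : MapsTo T W W)
    (n : ℕ) (x : E) :
    (interpolationScale hW h0 hball).p n (T x) ≤ (interpolationScale hW h0 hball).p n x := by
  refine le_of_forall_gt_imp_ge_of_dense fun a ha => ?_
  obtain ⟨b, hb, hba, y, hy, rfl⟩ := exists_lt_of_gauge_lt (absorbent_interpolationBall h0 n) ha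
  obtain ⟨w, hw, hyw⟩ := mem_interpolationBall.1 hy
  refine (gauge_le_of_mem hb.le ⟨T y, mem_interpolationBall.2 ⟨T w, hTW hw, ?_⟩, ?_⟩).trans hba.le
  · rw [← map_smul, ← map_sub]
    exact (T.le_of_opNorm_le hT _).trans (by rwa [one_mul])
  · simp

/-- A vector with relatively weakly compact orbit under a semigroup of contractions comes from an
invariant reflexive space continuously embedded in `E`. -/
theorem exists_normScale_of_isCompact_orbit [CompleteSpace E] {S : Type*} (T : S → E →L[ℝ] E)
    (hT : ∀ s, ‖T s‖ ≤ 1) (f : E) (hmul : ∀ s t, ∃ r, T s (T t f) = T r f)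
    (hf : IsCompact (closure (toWeakSpace ℝ E '' range fun s => T s f))) :
    ∃ P : NormScale E, (∀ s n x, P.p n (T s x) ≤ P.p n x) ∧ IsReflexiveSpace P.Space ∧
      ∃ v, P.incl v = f := by
  set c : ℝ := (2 * (‖f‖ + 1))⁻¹ with hc
  have hc0 : 0 < c := by positivity
  have hcf : ‖c • f‖ ≤ 1 / 2 := by
    rw [norm_smul, Real.norm_of_nonneg hc0.le, hc, inv_mul_le_iff₀ (by positivity)]
    linarith
  -- The vector itself is adjoined because S may have no identity, so it need not belong to its
  -- orbit.
  set A : Set E := insert (c • f) (range fun s => T s (c • f))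
  set W : Set E := absConvexHull ℝ A
  have hcfW : c • f ∈ W := subset_absConvexHull (mem_insert _ _)
  have hW : AbsConvex ℝ W := absConvex_absConvexHull
  have h0 : (0 : E) ∈ W := hW.1.zero_mem ⟨_, hcfW⟩
  have hball : W ⊆ closedBall 0 (1 / 2) := by
    refine absConvexHull_min ?_ ⟨balanced_closedBall_zero, convex_closedBall _ _⟩
    rintro _ (rfl | ⟨s, rfl⟩)
    · simpa using hcf
    · simpa using ((T s).le_of_opNorm_le_of_le (hT s) hcf).trans (one_mul _).le
  have hTA : ∀ s, MapsTo (T s) A A := by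
    rintro s _ (rfl | ⟨t, rfl⟩)
    · exact Or.inr ⟨s, rfl⟩
    · obtain ⟨r, hr⟩ := hmul s t
      exact Or.inr ⟨r, by simp only [map_smul, hr]⟩
  have hTW : ∀ s, MapsTo (T s) W W := fun s => by
    refine absConvexHull_min (t := T s ⁻¹' W) (fun x hx => subset_absConvexHull (hTA s hx)) ⟨?_, ?_⟩
    · rintro a ha _ ⟨x, hx, rfl⟩
      rw [mem_preimage, map_smul]
      exact hW.1.smul_mem ha hx
    · exact hW.2.linear_preimage (T s).toLinearMap
  obtain ⟨L, hWL, hL⟩ : ∃ L : Set E, W ⊆ L ∧ IsCompact (toWeakSpace ℝ E '' L) := by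
    set C : Set E := toWeakSpace ℝ E ⁻¹' closure (toWeakSpace ℝ E '' range fun s => T s f)
    have hC : IsCompact (toWeakSpace ℝ E '' C) := by
      rwa [image_preimage_eq _ (toWeakSpace ℝ E).surjective]
    have hTC : ∀ s, T s f ∈ C := fun s => by
      rw [mem_preimage]
      exact subset_closure ⟨_, ⟨s, rfl⟩, rfl⟩
    have hC' : IsCompact (toWeakSpace ℝ E '' insert f C) := by
      rw [insert_eq, image_union, image_singleton]
      exact isCompact_singleton.union hC
    have hsub : ∀ x ∈ A, ∃ y ∈ insert f C, c • y = x := by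
      rintro _ (rfl | ⟨s, rfl⟩)
      · exact ⟨f, mem_insert _ _, rfl⟩
      · exact ⟨T s f, Or.inr (hTC s), (map_smul _ _ _).symm⟩
    have hpos := isCompact_toWeakSpace_image_clm (c • ContinuousLinearMap.id ℝ E) hC'
    have hneg := isCompact_toWeakSpace_image_clm (-(c • ContinuousLinearMap.id ℝ E)) hC'
    -- Krein's theorem concerns convex hulls; the absolutely convex hull of A is the convex hull of
    -- A ∪ -A.
    have hun := hpos.union hneg
    rw [← image_union] at hun
    obtain ⟨L, hKL, hL⟩ := exists_isCompact_toWeakSpace_convexHull_subset hun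
    refine ⟨L, ?_, hL⟩
    rw [show W = convexHull ℝ (A ∪ -A) from convexHull_union_neg_eq_absConvexHull.symm]
    refine (convexHull_mono (union_subset_union (fun x hx => ?_) fun x hx => ?_)).trans hKL
    · obtain ⟨y, hy, rfl⟩ := hsub x hx
      exact ⟨y, hy, rfl⟩
    · obtain ⟨y, hy, hyx⟩ := hsub _ hx
      exact ⟨y, hy, by simp [hyx]⟩
  refine ⟨interpolationScale hW h0 hball,
    fun s n x => interpolationScale_p_apply_le hW h0 hball (hT s) (hTW s) n x,
    isReflexiveSpace_interpolationScale hW h0 hball hWL hL, ?_⟩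
  obtain ⟨v, hv⟩ := exists_incl_interpolationScale_eq hW h0 hball hcfW
  exact ⟨c⁻¹ • v, by rw [map_smul, hv, smul_smul, inv_mul_cancel₀ hc0.ne', one_smul]⟩

end Interpolation

/-! ### Fragmentability of weakly compact sets by the norm -/

section Fragmentability

variable {E : Type*} [NormedAddCommGroup E] [NormedSpace ℝ E]

theorem continuous_toWeakSpace_comp {S : Type*} [TopologicalSpace S] {u : S → E}
    (h : ∀ φ : StrongDual ℝ E, Continuous fun s => φ (u s)) :
    Continuous fun s => toWeakSpace ℝ E (u s) :=
  WeakBilin.continuous_of_continuous_eval _ h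

theorem continuous_eval_toWeakSpace_symm (φ : StrongDual ℝ E) :
    Continuous fun x : WeakSpace ℝ E => φ ((toWeakSpace ℝ E).symm x) :=
  WeakBilin.eval_continuous (topDualPairing ℝ E).flip φ

theorem isClosed_toWeakSpace_image {C : Set E} (hC : Convex ℝ C) (hC' : IsClosed C) :
    IsClosed (toWeakSpace ℝ E '' C) := by
  have := hC.toWeakSpace_closure (𝕜 := ℝ)
  rw [hC'.closure_eq] at this
  rw [this]
  exact isClosed_closure

/-- The weak closure in terms of finitely many functionals. -/
theorem toWeakSpace_mem_closure_iff {A : Set E} {x : E} :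
    toWeakSpace ℝ E x ∈ closure (toWeakSpace ℝ E '' A) ↔
      ∀ (F : Finset (StrongDual ℝ E)) (ε : ℝ), 0 < ε → ∃ a ∈ A, ∀ φ ∈ F, |φ a - φ x| < ε := by
  classical
  constructor
  · intro h F ε hε
    have hopen : IsOpen (⋂ φ ∈ F, {y : WeakSpace ℝ E | |φ ((toWeakSpace ℝ E).symm y) - φ x| < ε}) :=
      isOpen_biInter_finset fun φ _ => isOpen_lt
        ((continuous_eval_toWeakSpace_symm φ).sub continuous_const).abs continuous_const
    obtain ⟨_, hy, a, ha, rfl⟩ := mem_closure_iff.1 h _ hopen (by simp [hε])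
    refine ⟨a, ha, fun φ hφ => ?_⟩
    simpa using mem_iInter₂.1 hy φ hφ
  · intro h
    choose a ha hF using fun p : Finset (StrongDual ℝ E) × ℕ =>
      h p.1 (1 / (p.2 + 1 : ℝ)) Nat.one_div_pos_of_nat
    have ht : Tendsto (fun p => toWeakSpace ℝ E (a p)) atTop (𝓝 (toWeakSpace ℝ E x)) := by
      refine (WeakBilin.tendsto_iff_forall_eval_tendsto _
        injective_topDualPairing_flip).2 fun φ => ?_
      refine Metric.tendsto_atTop.2 fun ε hε => ?_
      obtain ⟨n, hn⟩ := exists_nat_one_div_lt hε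
      refine ⟨({φ}, n), fun p hp => ?_⟩
      rw [Real.dist_eq]
      refine (hF p φ (hp.1 (Finset.mem_singleton_self φ))).trans (lt_of_le_of_lt ?_ hn)
      have : (n : ℝ) ≤ p.2 := by exact_mod_cast hp.2
      exact one_div_le_one_div_of_le (by positivity) (by linarith)
    exact mem_closure_of_tendsto ht (.of_forall fun p => mem_image_of_mem _ (ha p))

/-- Kaplansky's theorem: the weak topology of a normed space has countable tightness. -/
theorem exists_countable_toWeakSpace_mem_closure {A : Set E} {x : E}
    (hx : toWeakSpace ℝ E x ∈ closure (toWeakSpace ℝ E '' A)) :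
    ∃ C ⊆ A, C.Countable ∧ toWeakSpace ℝ E x ∈ closure (toWeakSpace ℝ E '' C) := by
  classical
  rw [toWeakSpace_mem_closure_iff] at hx
  -- For n functionals of norm at most m, some point of A is close to x. Compactness of the n-th
  -- power of the weak* ball reduces the choice to finitely many points, and countably many pairs
  -- (n, m) suffice.
  have key : ∀ n m : ℕ, ∃ t : Finset A, ∀ φ : Fin n → StrongDual ℝ E, (∀ i, ‖φ i‖ ≤ m) →
      ∃ a ∈ t, ∀ i, |φ i a - φ i x| < 1 / (m + 1 : ℝ) := by
    intro n m
    have hc : IsCompact (Set.pi univ fun _ : Fin n =>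
        WeakDual.toStrongDual ⁻¹' closedBall (0 : StrongDual ℝ E) m) :=
      isCompact_univ_pi fun _ => WeakDual.isCompact_closedBall (𝕜 := ℝ) (E := E) 0 m
    obtain ⟨t, ht⟩ := hc.elim_finite_subcover
      (fun a : A => ⋂ i, {φ : Fin n → WeakDual ℝ E | |φ i a - φ i x| < 1 / (m + 1 : ℝ)})
      (fun a => isOpen_iInter_of_finite fun i => isOpen_lt
        (((WeakDual.eval_continuous (a : E)).comp (continuous_apply i)).sub
          ((WeakDual.eval_continuous x).comp (continuous_apply i))).abs continuous_const)
      (fun φ _ => by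
        obtain ⟨a, ha, h⟩ := hx (Finset.univ.image fun i => WeakDual.toStrongDual (φ i))
          (1 / (m + 1 : ℝ)) Nat.one_div_pos_of_nat
        refine mem_iUnion.2 ⟨⟨a, ha⟩, mem_iInter.2 fun i => ?_⟩
        exact h _ (Finset.mem_image_of_mem _ (Finset.mem_univ i)))
    refine ⟨t, fun φ hφ => ?_⟩
    obtain ⟨a, hat, ha⟩ := mem_iUnion₂.1 (ht (show (fun i => StrongDual.toWeakDual (φ i)) ∈ _ from
      fun i _ => by simpa using hφ i))
    exact ⟨a, hat, fun i => mem_iInter.1 ha i⟩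
  choose t ht using key
  refine ⟨⋃ n, ⋃ m, Subtype.val '' (t n m : Set A), ?_, ?_, ?_⟩
  · refine iUnion_subset fun n => iUnion_subset fun m => ?_
    rintro _ ⟨a, -, rfl⟩
    exact a.2
  · exact countable_iUnion fun n => countable_iUnion fun m =>
      (t n m).countable_toSet.image _
  · rw [toWeakSpace_mem_closure_iff]
    intro F ε hε
    obtain ⟨m₁, hm₁⟩ := exists_nat_one_div_lt hε
    obtain ⟨m₂, hm₂⟩ := exists_nat_ge (∑ φ ∈ F, ‖φ‖)
    obtain ⟨a, ha, h⟩ := ht F.card (max m₁ m₂) (fun i => (F.equivFin.symm i : StrongDual ℝ E))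
      fun i => (Finset.single_le_sum (f := fun φ : StrongDual ℝ E => ‖φ‖)
        (fun φ _ => norm_nonneg φ) (F.equivFin.symm i).2).trans
        (hm₂.trans (by exact_mod_cast le_max_right m₁ m₂))
    refine ⟨a, mem_iUnion₂.2 ⟨_, _, mem_image_of_mem _ ha⟩, fun φ hφ => ?_⟩
    have := h (F.equivFin ⟨φ, hφ⟩)
    simp only [Equiv.symm_apply_apply] at this
    refine this.trans (lt_of_le_of_lt ?_ hm₁)
    have : (m₁ : ℝ) ≤ (max m₁ m₂ : ℕ) := by exact_mod_cast le_max_left m₁ m₂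
    exact one_div_le_one_div_of_le (by positivity) (by linarith)

/-- A weakly compact set which is the weak closure of a countable set `B` cannot have the property
that every point of `B` is a weak limit of points of `B` at distance at least `δ`. -/
theorem not_forall_mem_closure_of_countable {K B : Set E} (hK : IsCompact (toWeakSpace ℝ E '' K))
    (hBK : B ⊆ K) (hB : B.Countable) (hne : B.Nonempty) {δ : ℝ} (hδ : 0 < δ) :
    ¬ ∀ b ∈ B, toWeakSpace ℝ E b ∈ closure (toWeakSpace ℝ E '' {c ∈ B | δ < ‖c - b‖}) := by
  intro h
  set Z := closure (toWeakSpace ℝ E '' B)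
  have hZ : IsCompact Z :=
    hK.of_isClosed_subset isClosed_closure (closure_minimal (image_mono hBK) hK.isClosed)
  obtain ⟨D, hD, hBD⟩ := hB.isSeparable.span (R := ℝ)
  set M : Submodule ℝ E := Submodule.span ℝ B
  -- By Mazur's theorem the closed span of B is weakly closed, so Z is norm separable. The Baire
  -- theorem on Z then gives a weakly open piece within δ/4 of one point d, too small to contain two
  -- points at distance more than δ.
  have hZD : Z ⊆ toWeakSpace ℝ E '' closure D := by
    have h1 : Z ⊆ toWeakSpace ℝ E '' closure (M : Set E) := by
      rw [Convex.toWeakSpace_closure (𝕜 := ℝ) M.convex]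
      exact closure_mono (image_mono Submodule.subset_span)
    exact h1.trans (image_mono (closure_minimal hBD isClosed_closure))
  have : CompactSpace Z := isCompact_iff_compactSpace.1 hZ
  obtain ⟨b₀, hb₀⟩ := hne
  have : Nonempty Z := ⟨⟨_, subset_closure (mem_image_of_mem _ hb₀)⟩⟩
  have : Countable D := hD.to_subtype
  obtain ⟨d, z, hz⟩ := nonempty_interior_of_iUnion_of_closed (X := Z)
    (f := fun d : D => Subtype.val ⁻¹' (toWeakSpace ℝ E '' closedBall (d : E) (δ / 4)))
    (fun d => (isClosed_toWeakSpace_image (convex_closedBall _ _) isClosed_closedBall).preimage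
      continuous_subtype_val)
    (eq_univ_of_forall fun z => by
      obtain ⟨y, hy, hyz⟩ := hZD z.2
      obtain ⟨d, hd, hyd⟩ := Metric.mem_closure_iff.1 hy (δ / 4) (by positivity)
      exact mem_iUnion.2 ⟨⟨d, hd⟩, y, hyd.le, hyz⟩)
  obtain ⟨U', hU', hU'o, hzU'⟩ := mem_interior.1 hz
  obtain ⟨U, hU, rfl⟩ := isOpen_induced_iff.1 hU'o
  obtain ⟨_, hbU, b, hb, rfl⟩ := mem_closure_iff.1 z.2 U hU hzU'
  obtain ⟨_, hcU, c, ⟨hc, hcb⟩, rfl⟩ := mem_closure_iff.1 (h b hb) U hU hbU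
  have hsmall : ∀ y ∈ B, toWeakSpace ℝ E y ∈ U → ‖y - d‖ ≤ δ / 4 := fun y hy hyU => by
    obtain ⟨y', hy', hyy'⟩ := hU' (a := ⟨_, subset_closure (mem_image_of_mem _ hy)⟩) hyU
    rw [(toWeakSpace ℝ E).injective hyy', mem_closedBall, dist_eq_norm] at hy'
    exact hy'
  have h1 := hsmall b hb hbU
  have h2 := hsmall c hc hcU
  have h3 : ‖c - b‖ ≤ ‖c - d‖ + ‖b - d‖ := by
    rw [show c - b = (c - d) - (b - d) by abel]
    exact norm_sub_le _ _
  linarith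

/-- Weakly compact sets are fragmented by the norm. -/
theorem exists_isOpen_norm_sub_le {K A : Set E} (hK : IsCompact (toWeakSpace ℝ E '' K))
    (hAK : A ⊆ K) (hA : A.Nonempty) {ε : ℝ} (hε : 0 < ε) :
    ∃ O : Set (WeakSpace ℝ E), IsOpen O ∧ (∃ a ∈ A, toWeakSpace ℝ E a ∈ O) ∧
      ∀ a ∈ A, ∀ b ∈ A, toWeakSpace ℝ E a ∈ O → toWeakSpace ℝ E b ∈ O → ‖a - b‖ ≤ ε := by
  by_contra! hcon
  have hcl : ∀ a ∈ A, toWeakSpace ℝ E a ∈ closure (toWeakSpace ℝ E '' {c ∈ A | ε / 2 < ‖c - a‖}) := by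
    refine fun a ha => mem_closure_iff.2 fun O hO haO => ?_
    obtain ⟨b, hb, c, hc, hbO, hcO, hbc⟩ := hcon O hO ⟨a, ha, haO⟩
    by_cases h : ε / 2 < ‖b - a‖
    · exact ⟨_, hbO, b, ⟨hb, h⟩, rfl⟩
    -- Of two points more than ε apart, at least one is more than ε/2 away from a.
    · refine ⟨_, hcO, c, ⟨hc, ?_⟩, rfl⟩
      have : ‖b - c‖ ≤ ‖b - a‖ + ‖c - a‖ := by
        rw [show b - c = (b - a) - (c - a) by abel]
        exact norm_sub_le _ _
      linarith
  choose! C hCA hC hCcl using fun a ha => exists_countable_toWeakSpace_mem_closure (hcl a ha)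
  obtain ⟨a₀, ha₀⟩ := hA
  -- Iterating a ↦ C a from one point gives a countable union in which every point is a weak limit
  -- of far points of the same union.
  let B : ℕ → Set E := fun n => Nat.rec {a₀} (fun _ B => ⋃ b ∈ B, C b) n
  have hBs : ∀ n, B (n + 1) = ⋃ b ∈ B n, C b := fun n => rfl
  have hB : ∀ n, B n ⊆ A ∧ (B n).Countable := fun n => by
    induction n with
    | zero => exact ⟨singleton_subset_iff.2 ha₀, countable_singleton _⟩
    | succ n ih =>
      rw [hBs]
      exact ⟨iUnion₂_subset fun b hb c hc => (hCA b (ih.1 hb) hc).1,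
        ih.2.biUnion fun b hb => hC b (ih.1 hb)⟩
  refine not_forall_mem_closure_of_countable hK ((iUnion_subset fun n => (hB n).1).trans hAK)
    (countable_iUnion fun n => (hB n).2) ⟨a₀, mem_iUnion.2 ⟨0, rfl⟩⟩ (half_pos hε) fun b hb => ?_
  obtain ⟨n, hn⟩ := mem_iUnion.1 hb
  have hsub : C b ⊆ {c | c ∈ ⋃ n, B n ∧ ε / 2 < ‖c - b‖} := fun c hc =>
    ⟨mem_iUnion.2 ⟨n + 1, by rw [hBs]; exact mem_iUnion₂.2 ⟨b, hn, hc⟩⟩,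
      (hCA b ((hB n).1 hn) hc).2⟩
  exact closure_mono (image_mono hsub) (hCcl b ((hB n).1 hn))

/-- A weakly continuous map into a weakly compact set whose range is homogeneous under isometries
is norm continuous. -/
theorem continuous_of_homogeneous {S : Type*} [TopologicalSpace S] {u : S → E} {K : Set E}
    (hK : IsCompact (toWeakSpace ℝ E '' K)) (huK : ∀ s, u s ∈ K)
    (hu : ∀ φ : StrongDual ℝ E, Continuous fun s => φ (u s))
    (hR : ∀ s t, ∃ R : E →L[ℝ] E, (∀ x, ‖R x‖ = ‖x‖) ∧ R (u s) = u t ∧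
      ∀ r, R (u r) ∈ range u) : Continuous u := by
  refine continuous_iff_continuousAt.2 fun s => Metric.tendsto_nhds.2 fun ε hε => ?_
  obtain ⟨O, hO, ⟨_, ⟨t, rfl⟩, htO⟩, hsmall⟩ := exists_isOpen_norm_sub_le hK
    (range_subset_iff.2 huK) ⟨u s, mem_range_self s⟩ (half_pos hε)
  -- The isometry moves u s to the point u t of the small piece; weak continuity keeps R (u r) in
  -- that piece for r near s, and R preserves distances.
  obtain ⟨R, hRn, hRs, hRr⟩ := hR s t
  have hcont : Continuous fun r => toWeakSpace ℝ E (R (u r)) :=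
    continuous_toWeakSpace_comp fun φ => hu (φ.comp R)
  have hev : ∀ᶠ r in 𝓝 s, toWeakSpace ℝ E (R (u r)) ∈ O :=
    hcont.continuousAt.eventually (hO.mem_nhds (by simpa only [hRs] using htO))
  filter_upwards [hev] with r hr
  have := hsmall _ (hRr r) _ (hRr s) hr (by rwa [hRs])
  rw [← map_sub, hRn] at this
  rw [dist_eq_norm]
  linarith

end Fragmentability

/-! ### Representations on reflexive spaces and translations of functions -/

noncomputable section

section Separating

variable {V : Type*} [NormedAddCommGroup V] [NormedSpace ℝ V]

/-- In a reflexive space, the weak continuity of a bounded map can be tested on a separating set of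
functionals. -/
theorem IsReflexiveSpace.continuous_of_separating (hV : IsReflexiveSpace V) {S : Type*}
    [TopologicalSpace S] {u : S → V} {M : ℝ} (hu : ∀ s, ‖u s‖ ≤ M) {D : Set (StrongDual ℝ V)}
    (hD : ∀ x y, (∀ φ ∈ D, φ x = φ y) → x = y) (hc : ∀ φ ∈ D, Continuous fun s => φ (u s))
    (φ : StrongDual ℝ V) : Continuous fun s => φ (u s) := by
  refine continuous_iff_continuousAt.2 fun s₀ => (tendsto_iff_ultrafilter _ _ _).2 fun 𝒰 h𝒰 => ?_
  -- Bounded ultrafilters converge weakly, and the separating functionals identify the limit as u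
  -- s₀.
  obtain ⟨y, -, hy⟩ := hV.exists_tendsto (𝒰.map u) (r := M)
    (Ultrafilter.mem_map.2 (univ_mem' fun s => by simpa using hu s))
  obtain rfl : y = u s₀ := hD _ _ fun ψ hψ => tendsto_nhds_unique
    (show Tendsto (fun s => ψ (u s)) 𝒰 _ from hy ψ) (((hc ψ hψ).tendsto s₀).mono_left h𝒰)
  exact hy φ

end Separating

namespace EquivariantPair

variable {S X V : Type*} [Semigroup S] [TopologicalSpace X] [SemigroupAction S X]
  [NormedAddCommGroup V] [NormedSpace ℝ V] (r : EquivariantPair S X V)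

theorem norm_h_le (s : S) : ‖((r.h s).unop : V →L[ℝ] V)‖ ≤ 1 := (r.h s).unop.2

theorem h_mul_apply (s t : S) (v : V) : ((r.h (s * t)).unop : V →L[ℝ] V) v =
    ((r.h t).unop : V →L[ℝ] V) (((r.h s).unop : V →L[ℝ] V) v) := by
  rw [map_mul]
  rfl

theorem norm_α_apply_le (x : X) (v : V) : ‖(r.α x : WeakDual ℝ V) v‖ ≤ ‖v‖ := by
  have h : ‖WeakDual.toStrongDual (r.α x : WeakDual ℝ V)‖ ≤ 1 :=
    mem_closedBall_zero_iff.1 (r.α x).2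
  simpa using (WeakDual.toStrongDual (r.α x : WeakDual ℝ V)).le_of_opNorm_le h v

/-- The bounded continuous functions represented by the vectors of `V`. -/
def coefficient : V →L[ℝ] (X →ᵇ ℝ) :=
  LinearMap.mkContinuous
    { toFun := fun v => BoundedContinuousFunction.ofNormedAddCommGroup
        (fun x => (r.α x : WeakDual ℝ V) v)
        ((WeakDual.eval_continuous v).comp (continuous_subtype_val.comp r.continuous_α)) ‖v‖
        fun x => r.norm_α_apply_le x v
      map_add' := fun v w => by ext x; exact map_add (r.α x : WeakDual ℝ V) v w
      map_smul' := fun c v => by ext x; exact map_smul (r.α x : WeakDual ℝ V) c v } 1 fun v => by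
    rw [one_mul]
    exact (BoundedContinuousFunction.norm_le (norm_nonneg v)).2 fun x => r.norm_α_apply_le x v

/-- Weakly continuous representations of groups on reflexive spaces are strongly continuous. -/
theorem IsWeaklyContinuous.isStronglyContinuous [TopologicalSpace S] {r : EquivariantPair S X V}
    (hr : r.IsWeaklyContinuous) (hV : IsReflexiveSpace V) (hS : IsGroupSemigroup S)
    (hid : r.PreservesIdentity) : r.IsStronglyContinuous := by
  obtain ⟨e, he, hinv⟩ := hS
  set R : S → V →L[ℝ] V := fun s => ((r.h s).unop : V →L[ℝ] V)
  have hle : ∀ s v, ‖R s v‖ ≤ ‖v‖ := fun s v =>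
    (ContinuousLinearMap.le_of_opNorm_le _ (r.norm_h_le s) v).trans (one_mul _).le
  have he1 : ∀ v, R e v = v := fun v => by
    simp only [R, hid e he]
    rfl
  have hnorm : ∀ s v, ‖R s v‖ = ‖v‖ := fun s v => by
    refine (hle s v).antisymm ?_
    obtain ⟨t, -, hst⟩ := hinv s
    calc ‖v‖ = ‖R t (R s v)‖ := by rw [← r.h_mul_apply, hst, he1]
      _ ≤ _ := hle _ _
  refine PointwiseConvergenceCLM.continuous_of_continuous_eval fun v => ?_
  refine continuous_of_homogeneous (u := fun s => R s v) (hV.isCompact_closedBall ‖v‖)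
    (fun s => by simpa using hle s v) (fun φ => ?_) fun s t => ?_
  · exact (ContinuousLinearMapWOT.continuous_dual_apply v φ).comp hr
  · obtain ⟨q, -, hq⟩ := hinv s
    -- With q inverse to s, reversal of products gives R (q * t) (R s v) = R (s * q * t) v = R t v.
    refine ⟨R (q * t), hnorm _, ?_, fun p => ⟨p * (q * t), r.h_mul_apply _ _ _⟩⟩
    rw [← r.h_mul_apply, ← mul_assoc, hq, (he t).1]

end EquivariantPair

section Flow

variable {S X : Type*} [Semigroup S] [TopologicalSpace S] [TopologicalSpace X]
  [SemigroupAction S X] [SemitopologicalFlow S X]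

/-- Translation as an operator on the space of bounded continuous functions. -/
def flowTranslateCLM (X : Type*) [TopologicalSpace X] [SemigroupAction S X]
    [SemitopologicalFlow S X] (s : S) : (X →ᵇ ℝ) →L[ℝ] (X →ᵇ ℝ) :=
  LinearMap.mkContinuous
    { toFun := fun F => flowTranslate F s
      map_add' := fun _ _ => rfl
      map_smul' := fun _ _ => rfl } 1 fun F => by
    rw [one_mul]
    exact (BoundedContinuousFunction.norm_le (norm_nonneg F)).2 fun x => F.norm_coe_le_norm _

theorem flowTranslateCLM_apply (s : S) (F : X →ᵇ ℝ) (x : X) :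
    flowTranslateCLM X s F x = F (s • x) := rfl

theorem norm_flowTranslateCLM_le (s : S) : ‖flowTranslateCLM X s‖ ≤ 1 :=
  LinearMap.mkContinuous_norm_le _ zero_le_one _

theorem flowTranslateCLM_mul (s t : S) (F : X →ᵇ ℝ) :
    flowTranslateCLM X (s * t) F = flowTranslateCLM X t (flowTranslateCLM X s F) := by
  ext x
  simp only [flowTranslateCLM_apply, mul_smul]

/-- Currying the jointly continuous function (s, x) ↦ F (s • x) gives a continuous map into C(X)
with the compact-open topology, which is the norm topology as X is compact. -/
theorem continuous_flowTranslateCLM [CompactSpace X]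
    (h : Continuous fun p : S × X => p.1 • p.2) (F : X →ᵇ ℝ) :
    Continuous fun s : S => flowTranslateCLM X s F := by
  let c : C(S × X, ℝ) := ⟨fun p => F (p.1 • p.2), F.continuous.comp h⟩
  exact (ContinuousMap.linearIsometryBoundedOfCompact X ℝ ℝ).continuous.comp c.curry.continuous

namespace EquivariantPair

variable {V : Type*} [NormedAddCommGroup V] [NormedSpace ℝ V] (r : EquivariantPair S X V)

theorem flowTranslate_coefficient (v : V) (s : S) :
    flowTranslate (r.coefficient v) s = r.coefficient (((r.h s).unop : V →L[ℝ] V) v) := by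
  ext x
  exact r.equivariant s x v

/-- Functions represented on reflexive spaces are weakly almost periodic. -/
theorem isWAP {r : EquivariantPair S X V} (hV : IsReflexiveSpace V) {v : V} {f : X → ℝ}
    (hf : r.Represents v f) : IsWAP S f := by
  refine ⟨r.coefficient v, funext fun x => (hf x).symm, ?_⟩
  have hK := isCompact_toWeakSpace_image_clm r.coefficient (hV.isCompact_closedBall ‖v‖)
  refine hK.of_isClosed_subset isClosed_closure (closure_minimal (image_mono ?_) hK.isClosed)
  rintro _ ⟨s, rfl⟩
  refine ⟨((r.h s).unop : V →L[ℝ] V) v, ?_, (r.flowTranslate_coefficient v s).symm⟩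
  rw [mem_closedBall_zero_iff]
  exact (ContinuousLinearMap.le_of_opNorm_le _ (r.norm_h_le s) v).trans (one_mul _).le

end EquivariantPair

/-- The equivariant pair on an invariant space continuously embedded in the space of bounded
continuous functions. -/
def NormScale.equivariantPair {E : Type*} [NormedAddCommGroup E] [NormedSpace ℝ E]
    (I : E ≃ₗᵢ[ℝ] (X →ᵇ ℝ)) (P : NormScale E) (T : S → E →L[ℝ] E)
    (hTI : ∀ s x, I (T s x) = flowTranslateCLM X s (I x))
    (hP : ∀ s n x, P.p n (T s x) ≤ P.p n x) : EquivariantPair S X P.Space where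
  h :=
    { toFun := fun s => MulOpposite.op ⟨P.map (T s) (hP s), P.norm_map_le _ _⟩
      map_mul' := fun s t => by
        refine MulOpposite.unop_injective (Subtype.ext (ContinuousLinearMap.ext fun v => ?_))
        refine P.incl_injective (I.injective ?_)
        change I (T (s * t) (P.incl v)) = I (T t (T s (P.incl v)))
        simp only [hTI, flowTranslateCLM_mul] }
  α x := ⟨StrongDual.toWeakDual ((BoundedContinuousFunction.evalCLM ℝ x).comp
      (I.toContinuousLinearEquiv.toContinuousLinearMap.comp P.incl)), by
    refine mem_closedBall_zero_iff.2 (ContinuousLinearMap.opNorm_le_bound _ zero_le_one fun v => ?_)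
    refine ((I (P.incl v)).norm_coe_le_norm x).trans ?_
    rw [I.norm_map, one_mul]
    exact P.norm_inclₗ_le v⟩
  continuous_α := continuous_induced_rng.2 (WeakDual.continuous_of_continuous_eval
    fun v => (I (P.incl v)).continuous)
  equivariant s x v := by
    change I (P.incl v) (s • x) = I (T s (P.incl v)) x
    rw [hTI, flowTranslateCLM_apply]

/-- Weakly almost periodic functions are represented on reflexive spaces. -/
theorem IsWAP.exists_equivariantPair {E : Type*} [NormedAddCommGroup E] [NormedSpace ℝ E]
    (I : E ≃ₗᵢ[ℝ] (X →ᵇ ℝ)) {f : X → ℝ} (hf : IsWAP S f) :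
    ∃ (P : NormScale E) (r : EquivariantPair S X P.Space) (v : P.Space),
      CompleteSpace P.Space ∧ IsReflexiveSpace P.Space ∧ r.IsWeaklyContinuous ∧
      r.PreservesIdentity ∧ r.Represents v f ∧
      (CompactSpace X → (Continuous fun p : S × X => p.1 • p.2) → r.IsStronglyContinuous) := by
  obtain ⟨F, rfl, hF⟩ := hf
  have : CompleteSpace E := I.isometry.isUniformInducing.completeSpace_congr I.surjective |>.2
    inferInstance
  let J := I.toContinuousLinearEquiv
  let T : S → E →L[ℝ] E := fun s =>
    J.symm.toContinuousLinearMap.comp ((flowTranslateCLM X s).comp J.toContinuousLinearMap)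
  have hTI : ∀ s x, I (T s x) = flowTranslateCLM X s (I x) := fun s x => I.apply_symm_apply _
  have hT : ∀ s, ‖T s‖ ≤ 1 := fun s => ContinuousLinearMap.opNorm_le_bound _ zero_le_one fun x => by
    rw [← I.norm_map, hTI, ← I.norm_map x]
    exact ContinuousLinearMap.le_of_opNorm_le _ (norm_flowTranslateCLM_le s) _
  have hmul : ∀ s t (x : E), T (s * t) x = T t (T s x) := fun s t x => I.injective (by
    simp only [hTI, flowTranslateCLM_mul])
  have horb : IsCompact (closure (toWeakSpace ℝ E '' range fun s => T s (I.symm F))) := by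
    set C := toWeakSpace ℝ (X →ᵇ ℝ) ⁻¹'
      closure (toWeakSpace ℝ (X →ᵇ ℝ) '' range fun s : S => flowTranslate F s)
    have hC : IsCompact (toWeakSpace ℝ (X →ᵇ ℝ) '' C) := by
      rwa [image_preimage_eq _ (toWeakSpace ℝ (X →ᵇ ℝ)).surjective]
    have hFC : ∀ s : S, flowTranslate F s ∈ C := fun s => by
      rw [mem_preimage]
      exact subset_closure ⟨_, ⟨s, rfl⟩, rfl⟩
    have hK := isCompact_toWeakSpace_image_clm J.symm.toContinuousLinearMap hC
    refine hK.of_isClosed_subset isClosed_closure (closure_minimal (image_mono ?_) hK.isClosed)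
    rintro _ ⟨s, rfl⟩
    refine ⟨_, hFC s, I.injective ?_⟩
    rw [hTI, I.apply_symm_apply]
    exact I.apply_symm_apply _
  obtain ⟨P, hP, hrefl, v, hv⟩ := exists_normScale_of_isCompact_orbit T hT (I.symm F)
    (fun s t => ⟨t * s, (hmul t s _).symm⟩) horb
  set r := P.equivariantPair I T hTI hP
  refine ⟨P, r, v, inferInstance, hrefl, ?_, ?_, ?_, ?_⟩
  · refine ContinuousLinearMapWOT.continuous_of_dual_apply_continuous fun u φ => ?_
    refine hrefl.continuous_of_separating (u := fun s => P.map (T s) (hP s) u) (M := ‖u‖)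
      (fun s => (ContinuousLinearMap.le_of_opNorm_le _ (P.norm_map_le _ _) u).trans (one_mul _).le)
      -- Evaluations at points separate the space, and on them continuity in s is continuity of the
      -- orbit maps s ↦ s • x.
      (D := range fun x => WeakDual.toStrongDual (r.α x : WeakDual ℝ P.Space)) ?_ ?_ φ
    · intro y z hyz
      refine P.incl_injective (I.injective (BoundedContinuousFunction.ext fun x => ?_))
      exact hyz _ ⟨x, rfl⟩
    · rintro _ ⟨x, rfl⟩
      change Continuous fun s => I (T s (P.incl u)) x
      simp only [hTI, flowTranslateCLM_apply]
      exact (I (P.incl u)).continuous.comp (SemitopologicalFlow.continuous_orbit x)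
  · intro e he
    refine MulOpposite.unop_injective (Subtype.ext (ContinuousLinearMap.ext fun u => ?_))
    refine P.incl_injective (I.injective (BoundedContinuousFunction.ext fun x => ?_))
    change I (T e (P.incl u)) x = I (P.incl u) x
    rw [hTI, flowTranslateCLM_apply, SemitopologicalFlow.identity_smul e he]
  · intro x
    change F x = I (P.incl v) x
    rw [hv, I.apply_symm_apply]
  · intro _ hc
    refine PointwiseConvergenceCLM.continuous_of_continuous_eval fun u => ?_
    refine P.continuous_map T hP u ?_
    exact J.symm.continuous.comp (continuous_flowTranslateCLM hc (I (P.incl u)))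

end Flow

end

/-! ### The representation theorem -/

theorem theorem4p4 {S : Type v} {X : Type u} [Semigroup S] [TopologicalSpace S]
    [TopologicalSpace X] [SemigroupAction S X] [SemitopologicalFlow S X] (f : X → ℝ) :
    List.TFAE [
      IsWAP S f,
      ∃ (V : Type (max u w)) (_ : NormedAddCommGroup V) (_ : NormedSpace ℝ V)
        (_ : CompleteSpace V) (r : EquivariantPair S X V) (v : V), IsReflexiveSpace V ∧
          r.IsWeaklyContinuous ∧ r.PreservesIdentity ∧ r.Represents v f,
      ∃ (V : Type (max u w)) (_ : NormedAddCommGroup V) (_ : NormedSpace ℝ V)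
        (_ : CompleteSpace V) (r : EquivariantPair S X V) (v : V), IsReflexiveSpace V ∧
          r.Represents v f] ∧
    ((IsGroupSemigroup S ∨
        (CompactSpace X ∧ T2Space X ∧ Continuous fun p : S × X => p.1 • p.2)) →
      (IsWAP S f ↔
        ∃ (V : Type (max u w)) (_ : NormedAddCommGroup V) (_ : NormedSpace ℝ V)
          (_ : CompleteSpace V) (r : EquivariantPair S X V) (v : V), IsReflexiveSpace V ∧
            r.IsStronglyContinuous ∧ r.PreservesIdentity ∧ r.Represents v f)) := by
  -- An isometric copy of the function space in the larger universe, where V is required to live.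
  have I : ULift.{w} (X →ᵇ ℝ) ≃ₗᵢ[ℝ] (X →ᵇ ℝ) := LinearIsometryEquiv.ulift ℝ (X →ᵇ ℝ)
  constructor
  · tfae_have 1 → 2 := fun hf => by
      obtain ⟨P, r, v, hc, hV, hw, hid, hr, -⟩ := hf.exists_equivariantPair I
      exact ⟨P.Space, _, _, hc, r, v, hV, hw, hid, hr⟩
    tfae_have 2 → 3 := fun ⟨V, i₁, i₂, i₃, r, v, hV, _, _, hr⟩ => ⟨V, i₁, i₂, i₃, r, v, hV, hr⟩
    tfae_have 3 → 1 := fun ⟨V, i₁, i₂, i₃, r, v, hV, hr⟩ => EquivariantPair.isWAP hV hr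
    tfae_finish
  · intro h
    refine ⟨fun hf => ?_, fun ⟨V, i₁, i₂, i₃, r, v, hV, _, _, hr⟩ => EquivariantPair.isWAP hV hr⟩
    obtain ⟨P, r, v, hc, hV, hw, hid, hr, hs⟩ := hf.exists_equivariantPair I
    refine ⟨P.Space, _, _, hc, r, v, hV, ?_, hid, hr⟩
    rcases h with hS | ⟨hX, -, hcont⟩
    · exact hw.isStronglyContinuous hV hS hid
    · exact hs hX hcont
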